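/- \textbf{Setting.} Let $X\in\mathbb R^{N\times M}$ have rows $x_1^T,\dots,x_N^T$, let $y\in\{0,1\}^{N\times K}$ be observed binary responses, $\mu_0\in\mathbb R^M$, and let $\Sigma_0\in\mathbb R^{M\times M}$ be symmetric positive definite. For $b>0$, $c\in\mathbb R$, the Pólya–Gamma distribution $\mathrm{PG}(b,c)$ is the law of $\frac1{2\pi^2}\sum_{r\ge1}\gamma_r/\big((r-\tfrac12)^2+c^2/(4\pi^2)\big)$ with $\gamma_r\sim\mathrm{Gamma}(b,1)$ independent. The IB-Logit model with Pólya–Gamma augmentation has weights $B=(\beta_1,\dots,\beta_K)$, $\beta_k\in\mathbb R^M$, and auxiliary variables $\Omega=(\omega_{ik})\in\mathbb R^{N\times K}$, with $\beta_k\sim\mathcal N(\mu_0,\Sigma_0)$ i.i.d. and, given $B$, all $y_{ik}\sim\mathrm{Bernoulli}\big(e^{x_i^T\beta_k}/(1+e^{x_i^T\beta_k})\big)$ and $\omega_{ik}\sim\mathrm{PG}(1,x_i^T\beta_k)$ independent. For a probability measure $q$ in $(\Omega,B)$ put $\mathrm{ELBO}(q)=\mathbb E_q[\log(p(y,\Omega,B)/q(\Omega,B))]\in[-\infty,\infty)$,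 with value $-\infty$ if $q$ is not absolutely continuous with respect to the model at $y$. A run of optimal mean-field coordinate ascent (CAVI) over $q(\Omega,B)=q(\Omega)\,q(B)$ starts at some $q_0(B)$ and for $t=0,1,2,\dots$ takes $q_t(\Omega)$ to be a maximizer of $\rho\mapsto\mathrm{ELBO}(\rho(\Omega)\,q_t(B))$, and then $q_{t+1}(B)$ to be a maximizer of $\rho\mapsto\mathrm{ELBO}(q_t(\Omega)\,\rho(B))$, each time over all probability measures $\rho$ on the respective space. \textbf{Proposition.} Put $\kappa_k=(y_{1k}-\tfrac12,\dots,y_{Nk}-\tfrac12)^T$. (1) Let $q(B)$ be a probability measure such that $\mathrm{ELBO}(\rho(\Omega)\,q(B))>-\infty$ for some probability measure $\rho$. Then each $\beta_k$ has finite second moments under $q(B)$, and $\rho\mapsto\mathrm{ELBO}(\rho(\Omega)\,q(B))$ has exactly one maximizer among all probability measures, namely $$q(\Omega)=\prod_{k=1}^K\prod_{i=1}^N\mathrm{PG}(\omega_{ik};1,c_{ik}),\qquad c_{ik}=\big(x_i^T\Sigma_kx_i+(x_i^T\mu_k)^2\big)^{1/2},$$ where $\mu_k$ and $\Sigma_k$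 are the mean and covariance of $\beta_k$ under $q(B)$. (2) Let $q(\Omega)$ be a probability measure such that $\mathrm{ELBO}(q(\Omega)\,\rho(B))>-\infty$ for some probability measure $\rho$. Then each $\omega_{ik}$ is integrable under $q(\Omega)$, the matrices $X^TW_kX+\Sigma_0^{-1}$ with $W_k=\mathrm{diag}(\mathbb E_q[\omega_{1k}],\dots,\mathbb E_q[\omega_{Nk}])$ are positive definite, and $\rho\mapsto\mathrm{ELBO}(q(\Omega)\,\rho(B))$ has exactly one maximizer among all probability measures, namely $$q(B)=\prod_{k=1}^K\mathcal N(\beta_k;\mu_k,\Sigma_k),\qquad \Sigma_k=\big(X^TW_kX+\Sigma_0^{-1}\big)^{-1},\quad \mu_k=\Sigma_k\big(X^T\kappa_k+\Sigma_0^{-1}\mu_0\big).$$ (3) For all $\mu_k$, positive definite $\Sigma_k$ and real $c_{ik}$, the measure $q=\prod_k\mathcal N(\beta_k;\mu_k,\Sigma_k)\prod_i\mathrm{PG}(\omega_{ik};1,c_{ik})$ has $\mathrm{ELBO}(q)>-\infty$; under it $\beta_k$ has mean $\mu_k$ and covariance $\Sigma_k$, and $$\mathbb E_q[\omega_{ik}]=\frac1{2c_{ik}}\,\frac{e^{c_{ik}}-1}{e^{c_{ik}}+1},$$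 read as its limit $\tfrac14$ when $c_{ik}=0$. (4) Consequently, if $q_0(B)$ satisfies the hypothesis of (1) (for example $q_0(B)=\prod_k\mathcal N(\beta_k;\mu_k,\Sigma_k)$ with positive definite $\Sigma_k$), sequences $q_t(\Omega)$, $q_{t+1}(B)$, $t\ge0$, form a CAVI run if and only if $q_t(\Omega)=\prod_{k,i}\mathrm{PG}(\omega_{ik};1,c^{(t)}_{ik})$ and $q_{t+1}(B)=\prod_k\mathcal N(\beta_k;\mu^{(t+1)}_k,\Sigma^{(t+1)}_k)$ for all $t$, where $\mu^{(0)}_k,\Sigma^{(0)}_k$ are the mean and covariance of $\beta_k$ under $q_0(B)$ and $$c^{(t)}_{ik}=\big(x_i^T\Sigma^{(t)}_kx_i+(x_i^T\mu^{(t)}_k)^2\big)^{1/2},\quad \Sigma^{(t+1)}_k=\big(X^TW^{(t)}_kX+\Sigma_0^{-1}\big)^{-1},\quad \mu^{(t+1)}_k=\Sigma^{(t+1)}_k\big(X^T\kappa_k+\Sigma_0^{-1}\mu_0\big),$$ with $W^{(t)}_k$ the diagonal matrix whose $i$-th entry is the expectation in (3) at $c_{ik}=c^{(t)}_{ik}$.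 -/

import Mathlib

open MeasureTheory ProbabilityTheory
open scoped ENNReal Matrix

noncomputable section

namespace IBLogit

/-! ### The Pólya–Gamma distribution -/

/-- `(1 / (2π²)) ∑_{r ≥ 1} γ_r / ((r - 1/2)² + c² / (4π²))`, with the summation index shifted so
that it starts at `0`. -/
def polyaGammaSeries (γ : ℕ → ℝ) (c : ℝ) : ℝ :=
  1 / (2 * Real.pi ^ 2) *
    ∑' r : ℕ, γ r / (((r : ℝ) + 1 / 2) ^ 2 + c ^ 2 / (4 * Real.pi ^ 2))

/-- The Pólya–Gamma distribution `PG(b, c)`, `b > 0`, `c ∈ ℝ`: the law of `polyaGammaSeries γ c`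
for independent `γ_r ∼ Gamma(b, 1)`. -/
def polyaGamma (b c : ℝ) : Measure ℝ :=
  (Measure.infinitePi (fun _ : ℕ => gammaMeasure b 1)).map (fun γ => polyaGammaSeries γ c)

/-- `b / (2c) * (e^c - 1) / (e^c + 1)`, with its limit `b / 4` as value at `c = 0`. -/
def polyaGammaMean (b c : ℝ) : ℝ :=
  if c = 0 then b / 4 else b / (2 * c) * ((Real.exp c - 1) / (Real.exp c + 1))

theorem measurable_polyaGammaSeries :
    Measurable (fun p : ℝ × (ℕ → ℝ) => polyaGammaSeries p.2 p.1) := by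
  unfold polyaGammaSeries
  refine Measurable.const_mul (Measurable.tsum (fun n => ?_)) _
  fun_prop

theorem measurable_polyaGammaSeries_left (c : ℝ) :
    Measurable (fun γ : ℕ → ℝ => polyaGammaSeries γ c) :=
  measurable_polyaGammaSeries.comp (measurable_const.prodMk measurable_id)

theorem isProbabilityMeasure_polyaGamma {b : ℝ} (hb : 0 < b) (c : ℝ) :
    IsProbabilityMeasure (polyaGamma b c) := by
  have : IsProbabilityMeasure (gammaMeasure b 1) :=
    isProbabilityMeasure_gammaMeasure hb one_pos
  exact Measure.isProbabilityMeasure_map (measurable_polyaGammaSeries_left c).aemeasurable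

instance (c : ℝ) : IsProbabilityMeasure (polyaGamma 1 c) :=
  isProbabilityMeasure_polyaGamma one_pos c

theorem measurable_polyaGamma : Measurable (polyaGamma 1) := by
  have : IsProbabilityMeasure (gammaMeasure 1 1) :=
    isProbabilityMeasure_gammaMeasure one_pos one_pos
  refine Measure.measurable_of_measurable_coe _ (fun s hs => ?_)
  have h : (fun c => polyaGamma 1 c s) = fun c =>
      Measure.infinitePi (fun _ : ℕ => gammaMeasure 1 1)
        (Prod.mk c ⁻¹' ((fun p : ℝ × (ℕ → ℝ) => polyaGammaSeries p.2 p.1) ⁻¹' s)) := by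
    funext c
    rw [polyaGamma, Measure.map_apply (measurable_polyaGammaSeries_left c) hs]
    rfl
  rw [h]
  exact measurable_measure_prodMk_left (measurable_polyaGammaSeries hs)

/-! ### The augmented model -/

/-- Regression weights `B = (β_1, …, β_K)`, with `β_k ∈ ℝ^M`. -/
abbrev Weights (M K : ℕ) : Type := Fin K → EuclideanSpace ℝ (Fin M)

/-- Auxiliary variables `Ω = (ω_ik) ∈ ℝ^{N × K}`. -/
abbrev Aux (N K : ℕ) : Type := Fin N → Fin K → ℝ

variable {N M K : ℕ}

/-- The linear predictor `η_ik = x_iᵀ β_k`, where `x_i` is the `i`-th row of `X`. -/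
def linPred (X : Matrix (Fin N) (Fin M) ℝ) (B : Weights M K) (i : Fin N) (k : Fin K) : ℝ :=
  X i ⬝ᵥ (B k).ofLp

/-- The likelihood `p(Y | B) = ∏_{i,k} H(η_ik)^{y_ik} (1 - H(η_ik))^{1 - y_ik}`, where
`H(η) = e^η / (1 + e^η)`. -/
def likelihood (X : Matrix (Fin N) (Fin M) ℝ) (y : Fin N → Fin K → Bool) (B : Weights M K) : ℝ :=
  ∏ i, ∏ k, if y i k
    then Real.exp (linPred X B i k) / (1 + Real.exp (linPred X B i k))
    else 1 - Real.exp (linPred X B i k) / (1 + Real.exp (linPred X B i k))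

/-- The law of `B` when `β_k ∼ N(μ_k, Σ_k)` independently. -/
def gaussianLaw (m : Fin K → EuclideanSpace ℝ (Fin M)) (S : Fin K → Matrix (Fin M) (Fin M) ℝ) :
    Measure (Weights M K) :=
  Measure.pi (fun k => multivariateGaussian (m k) (S k))

instance (m : Fin K → EuclideanSpace ℝ (Fin M)) (S : Fin K → Matrix (Fin M) (Fin M) ℝ) :
    IsProbabilityMeasure (gaussianLaw m S) := by
  unfold gaussianLaw; infer_instance

/-- The law of `Ω` when `ω_ik ∼ PG(b_ik, c_ik)` independently. -/
def polyaGammaLaw (b c : Fin N → Fin K → ℝ) : Measure (Aux N K) :=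
  Measure.pi (fun i => Measure.pi (fun k => polyaGamma (b i k) (c i k)))

instance (c : Fin N → Fin K → ℝ) :
    IsProbabilityMeasure (polyaGammaLaw (fun _ _ => 1) c) := by
  unfold polyaGammaLaw; infer_instance

theorem measurable_pi_of_measurable {α ι : Type*} [MeasurableSpace α] [Fintype ι]
    {β : ι → Type*} [∀ i, MeasurableSpace (β i)] {κ : (i : ι) → α → Measure (β i)}
    [∀ i a, IsProbabilityMeasure (κ i a)] (h : ∀ i, Measurable (κ i)) :
    Measurable (fun a => Measure.pi (fun i => κ i a)) := by
  refine Measurable.measure_of_isPiSystem_of_isProbabilityMeasure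
    generateFrom_pi.symm isPiSystem_pi ?_
  rintro _ ⟨s, hs, rfl⟩
  simp only [Measure.pi_pi]
  exact Finset.measurable_prod _ fun i _ =>
    (Measure.measurable_coe (hs i (Set.mem_univ i))).comp (h i)

theorem measurable_linPred (X : Matrix (Fin N) (Fin M) ℝ) (i : Fin N) (k : Fin K) :
    Measurable (fun B : Weights M K => linPred X B i k) := by
  unfold linPred dotProduct
  fun_prop

/-- The conditional law of `Ω` given `B`: `ω_ik ∼ PG(1, x_iᵀ β_k)` independently. -/
def auxKernel (X : Matrix (Fin N) (Fin M) ℝ) : Kernel (Weights M K) (Aux N K) where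
  toFun B := polyaGammaLaw (fun _ _ => 1) (linPred X B)
  measurable' :=
    measurable_pi_of_measurable fun i => measurable_pi_of_measurable fun k =>
      measurable_polyaGamma.comp (measurable_linPred X i k)

instance (X : Matrix (Fin N) (Fin M) ℝ) : IsMarkovKernel (auxKernel (K := K) X) :=
  ⟨fun B => inferInstanceAs (IsProbabilityMeasure (polyaGammaLaw (fun _ _ => 1) (linPred X B)))⟩

/-- The joint model at the observed responses, `p(Y, Ω, B) = p(Y | B) p(Ω | B) p(B)`, as a finite
measure in `(B, Ω)`; the prior is `β_k ∼ N(μ₀, Σ₀)`, independently over `k`. -/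
def jointMeasure (X : Matrix (Fin N) (Fin M) ℝ) (y : Fin N → Fin K → Bool)
    (μ₀ : EuclideanSpace ℝ (Fin M)) (S₀ : Matrix (Fin M) (Fin M) ℝ) :
    Measure (Weights M K × Aux N K) :=
  (gaussianLaw (fun _ : Fin K => μ₀) (fun _ => S₀) ⊗ₘ auxKernel X).withDensity
    (fun p => ENNReal.ofReal (likelihood X y p.1))

/-! ### Mean-field coordinate ascent -/

open scoped Classical in
/-- The evidence lower bound `E_q[log (p(Y, Ω, B) / q(Ω, B))]` of a probability measure `q`, where
the ratio is the Radon–Nikodym density. It is `-∞` if `q` is not absolutely continuous with respect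
to the model, and also if the log-ratio is not `q`-integrable: as the model is a finite measure, the
positive part of that log-ratio always has a finite integral. -/
def elbo (X : Matrix (Fin N) (Fin M) ℝ) (y : Fin N → Fin K → Bool)
    (μ₀ : EuclideanSpace ℝ (Fin M)) (S₀ : Matrix (Fin M) (Fin M) ℝ)
    (q : Measure (Weights M K × Aux N K)) : EReal :=
  if q ≪ jointMeasure X y μ₀ S₀ ∧ Integrable (llr q (jointMeasure X y μ₀ S₀)) q
    then ((∫ p, -llr q (jointMeasure X y μ₀ S₀) p ∂q : ℝ) : EReal)
    else ⊥

/-- `qΩ` maximizes the evidence lower bound of `q(Ω) q(B)` over all probability measures `q(Ω)`,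
with `q(B) = qB` held fixed. -/
def IsOptimalAux (X : Matrix (Fin N) (Fin M) ℝ) (y : Fin N → Fin K → Bool)
    (μ₀ : EuclideanSpace ℝ (Fin M)) (S₀ : Matrix (Fin M) (Fin M) ℝ)
    (qB : Measure (Weights M K)) (qΩ : Measure (Aux N K)) : Prop :=
  IsProbabilityMeasure qΩ ∧ ∀ ρ : Measure (Aux N K), IsProbabilityMeasure ρ →
    elbo X y μ₀ S₀ (qB.prod ρ) ≤ elbo X y μ₀ S₀ (qB.prod qΩ)

/-- `qB` maximizes the evidence lower bound of `q(Ω) q(B)` over all probability measures `q(B)`,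
with `q(Ω) = qΩ` held fixed. -/
def IsOptimalWeights (X : Matrix (Fin N) (Fin M) ℝ) (y : Fin N → Fin K → Bool)
    (μ₀ : EuclideanSpace ℝ (Fin M)) (S₀ : Matrix (Fin M) (Fin M) ℝ)
    (qΩ : Measure (Aux N K)) (qB : Measure (Weights M K)) : Prop :=
  IsProbabilityMeasure qB ∧ ∀ ρ : Measure (Weights M K), IsProbabilityMeasure ρ →
    elbo X y μ₀ S₀ (ρ.prod qΩ) ≤ elbo X y μ₀ S₀ (qB.prod qΩ)

/-- A run of optimal mean-field coordinate ascent started at `qB 0`: the factors `q(Ω)` and `q(B)`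
are replaced in turn by maximizers of the evidence lower bound, the other one held fixed. -/
def IsCAVIRun (X : Matrix (Fin N) (Fin M) ℝ) (y : Fin N → Fin K → Bool)
    (μ₀ : EuclideanSpace ℝ (Fin M)) (S₀ : Matrix (Fin M) (Fin M) ℝ)
    (qB : ℕ → Measure (Weights M K)) (qΩ : ℕ → Measure (Aux N K)) : Prop :=
  ∀ t, IsOptimalAux X y μ₀ S₀ (qB t) (qΩ t) ∧ IsOptimalWeights X y μ₀ S₀ (qΩ t) (qB (t + 1))

/-! ### Closed-form updates -/

/-- `μ_k = E_q[β_k]`. -/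
def weightsMean (q : Measure (Weights M K)) (k : Fin K) : EuclideanSpace ℝ (Fin M) :=
  ∫ B, B k ∂q

/-- `Σ_k = Cov_q(β_k)`. -/
def weightsCov (q : Measure (Weights M K)) (k : Fin K) : Matrix (Fin M) (Fin M) ℝ :=
  Matrix.of fun a b => cov[fun B => B k a, fun B => B k b; q]

/-- `E_q[ω_ik]`. -/
def auxMean (q : Measure (Aux N K)) (i : Fin N) (k : Fin K) : ℝ :=
  ∫ ω, ω i k ∂q

/-- `c_ik = (x_iᵀ Σ_k x_i + (x_iᵀ μ_k)²)^{1/2}`. -/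
def updateC (X : Matrix (Fin N) (Fin M) ℝ) (m : Fin K → EuclideanSpace ℝ (Fin M))
    (S : Fin K → Matrix (Fin M) (Fin M) ℝ) (i : Fin N) (k : Fin K) : ℝ :=
  Real.sqrt (X i ⬝ᵥ (S k *ᵥ X i) + (X i ⬝ᵥ (m k).ofLp) ^ 2)

/-- `κ_k = (y_1k - 1/2, …, y_Nk - 1/2)`. -/
def kappa (y : Fin N → Fin K → Bool) (k : Fin K) : Fin N → ℝ :=
  fun i => (if y i k then 1 else 0) - 1 / 2

/-- `Xᵀ W X + Σ₀⁻¹` with `W = diag(w_1k, …, w_Nk)`. -/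
def precision (X : Matrix (Fin N) (Fin M) ℝ) (S₀ : Matrix (Fin M) (Fin M) ℝ)
    (w : Fin N → Fin K → ℝ) (k : Fin K) : Matrix (Fin M) (Fin M) ℝ :=
  Xᵀ * Matrix.diagonal (fun i => w i k) * X + S₀⁻¹

/-- `Σ_k = (Xᵀ W X + Σ₀⁻¹)⁻¹`. -/
def updateS (X : Matrix (Fin N) (Fin M) ℝ) (S₀ : Matrix (Fin M) (Fin M) ℝ)
    (w : Fin N → Fin K → ℝ) (k : Fin K) : Matrix (Fin M) (Fin M) ℝ :=
  (precision X S₀ w k)⁻¹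

/-- `μ_k = Σ_k (Xᵀ κ_k + Σ₀⁻¹ μ₀)`, with `Σ_k` the updated covariance. -/
def updateM (X : Matrix (Fin N) (Fin M) ℝ) (y : Fin N → Fin K → Bool)
    (μ₀ : EuclideanSpace ℝ (Fin M)) (S₀ : Matrix (Fin M) (Fin M) ℝ)
    (w : Fin N → Fin K → ℝ) (k : Fin K) : EuclideanSpace ℝ (Fin M) :=
  WithLp.toLp 2 (updateS X S₀ w k *ᵥ (Xᵀ *ᵥ kappa y k + S₀⁻¹ *ᵥ μ₀.ofLp))

/-- The parameters `(μ_k, Σ_k)_k` after `t` sweeps of the closed-form algorithm. -/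
def paramIter (X : Matrix (Fin N) (Fin M) ℝ) (y : Fin N → Fin K → Bool)
    (μ₀ : EuclideanSpace ℝ (Fin M)) (S₀ : Matrix (Fin M) (Fin M) ℝ)
    (m : Fin K → EuclideanSpace ℝ (Fin M)) (S : Fin K → Matrix (Fin M) (Fin M) ℝ) :
    ℕ → (Fin K → EuclideanSpace ℝ (Fin M)) × (Fin K → Matrix (Fin M) (Fin M) ℝ)
  | 0 => (m, S)
  | t + 1 =>
    let p := paramIter X y μ₀ S₀ m S t
    let w : Fin N → Fin K → ℝ := fun i k => polyaGammaMean 1 (updateC X p.1 p.2 i k)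
    (updateM X y μ₀ S₀ w, updateS X S₀ w)

end IBLogit

end

noncomputable section

namespace IBLogit

open Filter Topology Set InformationTheory

/-! ### Laplace transforms -/

/-! Write `η = x_iᵀ β_k`. Two identities carry the theorem. The law `PG(1, c)` has density `cosh
(c/2) * exp (-c² ω / 2)` with respect to `PG(1, 0)` (`polyaGamma_eq_withDensity`), and each
Bernoulli factor equals `exp (κ η) / (2 cosh (η/2))`. In the joint model the hyperbolic cosines
cancel, leaving the density `exp (∑ (κ η - log 2) - ∑ ω η² / 2)` relative to the prior times
independent `PG(1, 0)` laws (`jointMeasure_eq_withExpDensity`).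

Hence, for a product `μ ⊗ ν`, the objective is `-KL(μ | prior) - KL(ν | PG(1, 0))` plus the `μ`-mean
of the linear part, minus `∑ E_μ[η² / 2] E_ν[ω]`; it is finite exactly when both relative entropies
are (`elbo_prod`). With `μ` fixed, the terms in `ν` are affine in `E_ν[ω]`, so tilting the reference
turns them into a constant minus `KL(ν | PG(1, c))` with `c² = E_μ[η²]`. With `ν` fixed, the
exponent is quadratic in `B`, and completing the square gives a constant minus the relative entropy
to a Gaussian. Relative entropy is nonnegative and vanishes only at its reference, which gives
existence and uniqueness of both maximizers.

Arbitrary probability measures compete, so integrability has to come from finiteness of the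
objective alone. The tool is the entropy bound `integrable_of_llr_le`: a function with an
exponential moment under the reference is integrable under any measure of finite relative entropy.
It is applied to `‖B‖²` (Fernique) and to `∑ |ω_ik|`; nonnegativity of `ω η²` lets it act before the
two factors have been separated (`klDiv_prod_withExpDensity`).

The tilting identity and the mean of `PG(1, c)` come from Laplace transforms: products of gamma
transforms are compared factor by factor, Euler's product yields `cosh`, and analytic continuation
identifies the laws. -/

instance : IsProbabilityMeasure (gammaMeasure 1 1) :=
  isProbabilityMeasure_gammaMeasure one_pos one_pos

theorem lintegral_exp_mul_gammaMeasure_one {t : ℝ} (ht : t < 1) :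
    ∫⁻ x, ENNReal.ofReal (Real.exp (t * x)) ∂(gammaMeasure 1 1) = ENNReal.ofReal (1 - t)⁻¹ := by
  have h1 : 0 < 1 - t := by linarith
  have hm : Measurable (gammaPDF 1 1) := (measurable_gammaPDFReal 1 1).ennreal_ofReal
  have hm' : Measurable (gammaPDF 1 (1 - t)) := (measurable_gammaPDFReal 1 (1 - t)).ennreal_ofReal
  rw [gammaMeasure, lintegral_withDensity_eq_lintegral_mul _ hm (by fun_prop)]
  have h (x : ℝ) : (gammaPDF 1 1 * fun x => ENNReal.ofReal (Real.exp (t * x))) x =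
      ENNReal.ofReal (1 - t)⁻¹ * gammaPDF 1 (1 - t) x := by
    rcases lt_or_ge x 0 with hx | hx
    · simp [gammaPDF_of_neg hx]
    · rw [Pi.mul_apply, gammaPDF_of_nonneg hx, gammaPDF_of_nonneg hx, ← ENNReal.ofReal_mul
        (by simp; positivity), ← ENNReal.ofReal_mul (by positivity)]
      congr 1
      simp only [Real.rpow_one, Real.Gamma_one, sub_self, Real.rpow_zero, div_one, mul_one, one_mul]
      rw [← mul_assoc, inv_mul_cancel₀ h1.ne', one_mul, ← Real.exp_add]
      ring_nf
  simp_rw [h]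
  rw [lintegral_const_mul _ hm', lintegral_gammaPDF_eq_one one_pos h1, mul_one]

theorem mgf_gammaMeasure_one {t : ℝ} (ht : t < 1) : mgf id (gammaMeasure 1 1) t = (1 - t)⁻¹ := by
  have h1 : 0 < 1 - t := by linarith
  rw [mgf, integral_eq_lintegral_of_nonneg_ae (Eventually.of_forall fun _ => (Real.exp_pos _).le)
    (by fun_prop)]
  simp only [id_eq]
  rw [lintegral_exp_mul_gammaMeasure_one ht, ENNReal.toReal_ofReal (by positivity)]

theorem ae_nonneg_gammaMeasure_one : ∀ᵐ x ∂(gammaMeasure 1 1), 0 ≤ x := by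
  have hm : Measurable (gammaPDF 1 1) := (measurable_gammaPDFReal 1 1).ennreal_ofReal
  rw [gammaMeasure, ae_withDensity_iff hm]
  refine Eventually.of_forall fun x hx => ?_
  by_contra h
  exact hx (gammaPDF_of_neg (not_le.mp h))

/-! ### Convergence and exponential moments of the Pólya–Gamma series -/

/-- The joint law of the independent `Gamma(1, 1)` variables in the Pólya–Gamma series. -/
abbrev gammaSeq : Measure (ℕ → ℝ) := Measure.infinitePi (fun _ : ℕ => gammaMeasure 1 1)

/-- The coefficients of the Pólya–Gamma series. -/
def pgCoeff (c : ℝ) (r : ℕ) : ℝ :=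
  1 / (2 * Real.pi ^ 2) / (((r : ℝ) + 1 / 2) ^ 2 + c ^ 2 / (4 * Real.pi ^ 2))

theorem pgCoeff_pos (c : ℝ) (r : ℕ) : 0 < pgCoeff c r := by
  unfold pgCoeff
  have := Real.pi_pos
  positivity

theorem summable_pgCoeff (c : ℝ) : Summable (pgCoeff c) := by
  have h : Summable fun n : ℕ => 1 / ((n : ℝ) + 1) ^ 2 := by
    have := (summable_nat_add_iff 1).mpr (Real.summable_one_div_nat_pow (p := 2).mpr one_lt_two)
    simpa using this
  -- The factor 4 comes from `r + 1/2 ≥ (r + 1) / 2`.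
  refine Summable.of_nonneg_of_le (fun r => (pgCoeff_pos c r).le) (fun r => ?_)
    (h.mul_left (1 / (2 * Real.pi ^ 2) * 4))
  have := Real.pi_pos
  unfold pgCoeff
  rw [div_eq_mul_one_div (1 / (2 * Real.pi ^ 2)), mul_assoc]
  gcongr
  rw [mul_one_div, div_le_div_iff₀ (by positivity) (by positivity)]
  have : 0 ≤ c ^ 2 / (4 * Real.pi ^ 2) := by positivity
  nlinarith [(r.cast_nonneg : (0 : ℝ) ≤ r)]

theorem polyaGammaSeries_eq_tsum (γ : ℕ → ℝ) (c : ℝ) :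
    polyaGammaSeries γ c = ∑' r, pgCoeff c r * γ r := by
  rw [polyaGammaSeries, ← tsum_mul_left]
  congr 1 with r
  unfold pgCoeff
  ring

theorem ae_nonneg_gammaSeq : ∀ᵐ γ ∂gammaSeq, ∀ r, 0 ≤ γ r := by
  rw [ae_all_iff]
  intro r
  exact (measurePreserving_eval_infinitePi (fun _ : ℕ => gammaMeasure 1 1) r).quasiMeasurePreserving.ae
    ae_nonneg_gammaMeasure_one

/-- The expected sum is finite. Off this event `tsum` takes the default value 0 and partial sums
need not approach it. -/
theorem ae_summable_gammaSeq (c : ℝ) : ∀ᵐ γ ∂gammaSeq, Summable fun r => pgCoeff c r * γ r := by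
  -- A crude bound on the mean suffices: `x ≤ 2 exp (x/2)`, and the transform at `1/2` equals 2.
  have hfin : ∫⁻ x, ENNReal.ofReal x ∂(gammaMeasure 1 1) ≤ ENNReal.ofReal 4 := by
    calc ∫⁻ x, ENNReal.ofReal x ∂(gammaMeasure 1 1)
        ≤ ∫⁻ x, 2 * ENNReal.ofReal (Real.exp (1 / 2 * x)) ∂(gammaMeasure 1 1) := by
          refine lintegral_mono fun x => ?_
          rw [← ENNReal.ofReal_ofNat, ← ENNReal.ofReal_mul (by norm_num)]
          refine ENNReal.ofReal_le_ofReal ?_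
          linarith [Real.add_one_le_exp (1 / 2 * x)]
      _ = ENNReal.ofReal 4 := by
          rw [lintegral_const_mul _ (by fun_prop), lintegral_exp_mul_gammaMeasure_one (by norm_num),
            ← ENNReal.ofReal_ofNat, ← ENNReal.ofReal_mul (by norm_num)]
          norm_num
  have hint : ∫⁻ γ, ∑' r, ENNReal.ofReal (pgCoeff c r * γ r) ∂gammaSeq ≠ ∞ := by
    rw [lintegral_tsum (fun r => Measurable.aemeasurable (by fun_prop))]
    have hr (r : ℕ) : ∫⁻ γ, ENNReal.ofReal (pgCoeff c r * γ r) ∂gammaSeq ≤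
        ENNReal.ofReal (pgCoeff c r * 4) := by
      have := (measurePreserving_eval_infinitePi (fun _ : ℕ => gammaMeasure 1 1) r).lintegral_comp
        (f := fun x => ENNReal.ofReal (pgCoeff c r * x)) (by fun_prop)
      simp only [Function.eval] at this
      rw [this]
      simp_rw [ENNReal.ofReal_mul (pgCoeff_pos c r).le]
      rw [lintegral_const_mul _ (by fun_prop)]
      gcongr
    refine ne_top_of_le_ne_top ?_ (ENNReal.tsum_le_tsum hr)
    exact ((summable_pgCoeff c).mul_right 4).tsum_ofReal_ne_top
  filter_upwards [ae_lt_top (Measurable.tsum fun r => by fun_prop) hint, ae_nonneg_gammaSeq] with γ h1 h2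
  have := ENNReal.summable_toReal h1.ne
  refine this.congr fun r => ?_
  exact ENNReal.toReal_ofReal (mul_nonneg (pgCoeff_pos c r).le (h2 r))

theorem mgf_partialSum {c t : ℝ} (ht : ∀ r, t * pgCoeff c r < 1) (n : ℕ) :
    mgf (fun γ : ℕ → ℝ => ∑ r ∈ Finset.range n, pgCoeff c r * γ r) gammaSeq t =
      ∏ r ∈ Finset.range n, (1 - t * pgCoeff c r)⁻¹ := by
  have hind : iIndepFun (fun (r : ℕ) (γ : ℕ → ℝ) => pgCoeff c r * γ r) gammaSeq :=
    iIndepFun_infinitePi (X := fun r x => pgCoeff c r * x) (fun r => by fun_prop)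
  have h := hind.mgf_sum (t := t) (fun r => by fun_prop) (Finset.range n)
  have h2 : (∑ r ∈ Finset.range n, fun γ : ℕ → ℝ => pgCoeff c r * γ r) =
      fun γ => ∑ r ∈ Finset.range n, pgCoeff c r * γ r := by
    ext γ; simp
  rw [← h2, h]
  refine Finset.prod_congr rfl fun r _ => ?_
  rw [← mgf_gammaMeasure_one (ht r), ← (measurePreserving_eval_infinitePi
    (fun _ : ℕ => gammaMeasure 1 1) r).map_eq, mgf_id_map (measurable_pi_apply r).aemeasurable, mgf, mgf]
  simp only [Function.eval]
  congr 1 with γ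
  ring_nf

/-- Weierstrass's inequality; it keeps the denominators of the partial transforms away from 0
uniformly in the number of factors. -/
theorem one_sub_sum_le_prod_one_sub (s : Finset ℕ) (f : ℕ → ℝ) (h0 : ∀ r ∈ s, 0 ≤ f r)
    (h1 : ∀ r ∈ s, f r ≤ 1) : 1 - ∑ r ∈ s, f r ≤ ∏ r ∈ s, (1 - f r) := by
  induction s using Finset.induction_on with
  | empty => simp
  | insert a s ha ih =>
    rw [Finset.sum_insert ha, Finset.prod_insert ha]
    have ih := ih (fun r hr => h0 r (Finset.mem_insert_of_mem hr))
      fun r hr => h1 r (Finset.mem_insert_of_mem hr)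
    have h0a := h0 a (Finset.mem_insert_self a s)
    have h1a := h1 a (Finset.mem_insert_self a s)
    have hs : 0 ≤ ∑ r ∈ s, f r := Finset.sum_nonneg fun r hr => h0 r (Finset.mem_insert_of_mem hr)
    nlinarith [mul_le_mul_of_nonneg_left ih (sub_nonneg.mpr h1a), mul_nonneg h0a hs]

/-- The transforms of the partial sums are bounded by 2 at a small `ε`, and Fatou's lemma passes the
bound to the series. -/
theorem exists_integrable_exp_polyaGammaSeries (c : ℝ) :
    ∃ ε > 0, (∀ r, ε * pgCoeff c r < 1) ∧
      Integrable (fun γ => Real.exp (ε * polyaGammaSeries γ c)) gammaSeq := by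
  set A := ∑' r, pgCoeff c r with hA
  have hApos : 0 < A := (summable_pgCoeff c).tsum_pos (fun r => (pgCoeff_pos c r).le) 0 (pgCoeff_pos c 0)
  have hle (n : ℕ) : ∑ r ∈ Finset.range n, pgCoeff c r ≤ A :=
    (summable_pgCoeff c).sum_le_tsum _ fun r _ => (pgCoeff_pos c r).le
  -- With this choice `1 - ε * ∑ pgCoeff ≥ 1/2` for every partial sum.
  set ε := 1 / (2 * A) with hε
  have hεpos : 0 < ε := by positivity
  have hεA : ε * A = 1 / 2 := by rw [hε]; field_simp
  have hr (r : ℕ) : ε * pgCoeff c r < 1 := by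
    have : pgCoeff c r ≤ A := (summable_pgCoeff c).le_tsum r fun r _ => (pgCoeff_pos c r).le
    nlinarith
  refine ⟨ε, hεpos, hr, ?_⟩
  have hmeas := measurable_polyaGammaSeries_left c
  refine ⟨by fun_prop, ?_⟩
  rw [hasFiniteIntegral_iff_ofReal (Eventually.of_forall fun _ => (Real.exp_pos _).le)]
  refine lt_of_le_of_lt ?_ (ENNReal.ofReal_lt_top (r := 2))
  calc ∫⁻ γ, ENNReal.ofReal (Real.exp (ε * polyaGammaSeries γ c)) ∂gammaSeq
      ≤ ∫⁻ γ, liminf (fun n => ENNReal.ofReal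
          (Real.exp (ε * ∑ r ∈ Finset.range n, pgCoeff c r * γ r))) atTop ∂gammaSeq := by
        refine lintegral_mono_ae ?_
        filter_upwards [ae_summable_gammaSeq c] with γ hγ
        refine le_of_eq (Tendsto.liminf_eq ?_).symm
        rw [polyaGammaSeries_eq_tsum]
        exact ENNReal.tendsto_ofReal ((Real.continuous_exp.tendsto _).comp
          (hγ.hasSum.tendsto_sum_nat.const_mul ε))
    _ ≤ liminf (fun n => ∫⁻ γ, ENNReal.ofReal
          (Real.exp (ε * ∑ r ∈ Finset.range n, pgCoeff c r * γ r)) ∂gammaSeq) atTop :=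
        lintegral_liminf_le fun n => by fun_prop
    _ ≤ ENNReal.ofReal 2 := by
        refine liminf_le_of_le (by isBoundedDefault) fun b hb => ?_
        obtain ⟨n, hn⟩ := hb.exists
        refine hn.trans ?_
        have hm := mgf_partialSum hr n
        have hprod : 1 / 2 ≤ ∏ r ∈ Finset.range n, (1 - ε * pgCoeff c r) := by
          refine le_trans ?_ (one_sub_sum_le_prod_one_sub _ _
            (fun r _ => mul_nonneg hεpos.le (pgCoeff_pos c r).le) fun r _ => (hr r).le)
          rw [← Finset.mul_sum]
          nlinarith [hle n]
        have hval : mgf (fun γ : ℕ → ℝ => ∑ r ∈ Finset.range n, pgCoeff c r * γ r) gammaSeq ε ≤ 2 := by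
          rw [hm, Finset.prod_inv_distrib]
          calc _ ≤ (1 / 2 : ℝ)⁻¹ := inv_anti₀ (by norm_num) hprod
            _ = 2 := by norm_num
        have hpos : 0 < mgf (fun γ : ℕ → ℝ => ∑ r ∈ Finset.range n, pgCoeff c r * γ r) gammaSeq ε := by
          rw [hm]
          exact Finset.prod_pos fun r _ => inv_pos.mpr (by linarith [hr r])
        -- A non-integrable exponential would make `mgf` equal to 0, so positivity certifies
        -- integrability.
        have hint := mgf_pos_iff.mp hpos
        rw [← ofReal_integral_eq_lintegral_ofReal hint
          (Eventually.of_forall fun _ => (Real.exp_pos _).le)]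
        exact ENNReal.ofReal_le_ofReal hval

theorem ae_nonneg_polyaGammaSeries (c : ℝ) : ∀ᵐ γ ∂gammaSeq, 0 ≤ polyaGammaSeries γ c := by
  filter_upwards [ae_nonneg_gammaSeq] with γ hγ
  rw [polyaGammaSeries_eq_tsum]
  exact tsum_nonneg fun r => mul_nonneg (pgCoeff_pos c r).le (hγ r)

theorem ae_nonneg_polyaGamma (c : ℝ) : ∀ᵐ w ∂(polyaGamma 1 c), 0 ≤ w := by
  rw [polyaGamma, ae_map_iff (measurable_polyaGammaSeries_left c).aemeasurable measurableSet_Ici]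
  exact ae_nonneg_polyaGammaSeries c

/-- Dominated convergence: the terms are nonnegative and `t ≤ ε`, so `exp (ε * series)` dominates
all partial exponentials, however negative `t` is. -/
theorem tendsto_prod_mgf_polyaGamma {c ε : ℝ} (hε : 0 ≤ ε) (hr : ∀ r, ε * pgCoeff c r < 1)
    (hint : Integrable (fun γ => Real.exp (ε * polyaGammaSeries γ c)) gammaSeq) {t : ℝ} (ht : t ≤ ε) :
    Tendsto (fun n => ∏ r ∈ Finset.range n, (1 - t * pgCoeff c r)⁻¹) atTop
      (𝓝 (mgf id (polyaGamma 1 c) t)) := by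
  have htr (r : ℕ) : t * pgCoeff c r < 1 :=
    (mul_le_mul_of_nonneg_right ht (pgCoeff_pos c r).le).trans_lt (hr r)
  simp_rw [← mgf_partialSum htr]
  rw [polyaGamma, mgf_id_map (measurable_polyaGammaSeries_left c).aemeasurable]
  refine tendsto_integral_of_dominated_convergence _
    (fun n => Measurable.aestronglyMeasurable (by fun_prop)) hint (fun n => ?_) ?_
  · filter_upwards [ae_summable_gammaSeq c, ae_nonneg_gammaSeq] with γ hs h0
    rw [Real.norm_of_nonneg (Real.exp_pos _).le, Real.exp_le_exp, polyaGammaSeries_eq_tsum]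
    have h1 : ∑ r ∈ Finset.range n, pgCoeff c r * γ r ≤ ∑' r, pgCoeff c r * γ r :=
      hs.sum_le_tsum _ fun r _ => mul_nonneg (pgCoeff_pos c r).le (h0 r)
    have h2 : 0 ≤ ∑ r ∈ Finset.range n, pgCoeff c r * γ r :=
      Finset.sum_nonneg fun r _ => mul_nonneg (pgCoeff_pos c r).le (h0 r)
    nlinarith
  · filter_upwards [ae_summable_gammaSeq c] with γ hs
    rw [polyaGammaSeries_eq_tsum]
    exact (Real.continuous_exp.tendsto _).comp (hs.hasSum.tendsto_sum_nat.const_mul t)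

/-! ### Euler's product for the hyperbolic cosine -/

theorem prod_range_two_mul (f : ℕ → ℂ) (n : ℕ) :
    ∏ j ∈ Finset.range (2 * n), f j =
      (∏ j ∈ Finset.range n, f (2 * j)) * ∏ j ∈ Finset.range n, f (2 * j + 1) := by
  induction n with
  | zero => simp
  | succ n ih =>
    rw [mul_add, mul_one, Finset.prod_range_succ, Finset.prod_range_succ, ih,
      Finset.prod_range_succ, Finset.prod_range_succ]
    ring

/-- Since `cos πz = sin 2πz / (2 sin πz)`, take `2n` factors of Euler's sine product at `2z`: those
of odd index form the product at `z` and cancel, those of even index remain. -/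
theorem tendsto_euler_cos_prod {z : ℂ} (hz : Complex.sin (Real.pi * z) ≠ 0) :
    Tendsto (fun n : ℕ => ∏ j ∈ Finset.range n, (1 - 4 * z ^ 2 / (2 * (j : ℂ) + 1) ^ 2)) atTop
      (𝓝 (Complex.cos (Real.pi * z))) := by
  have hz0 : z ≠ 0 := by rintro rfl; simp at hz
  have hpi : (Real.pi : ℂ) ≠ 0 := by exact_mod_cast Real.pi_ne_zero
  have h1 := Complex.tendsto_euler_sin_prod z
  have h2 := (Complex.tendsto_euler_sin_prod (2 * z)).comp
    (tendsto_id.const_mul_atTop' (zero_lt_two' ℕ))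
  have h3 := h2.div h1 hz
  have hlim : Complex.sin (Real.pi * (2 * z)) / Complex.sin (Real.pi * z) =
      2 * Complex.cos (Real.pi * z) := by
    rw [show (Real.pi : ℂ) * (2 * z) = 2 * (Real.pi * z) by ring, Complex.sin_two_mul]
    field_simp
  rw [hlim] at h3
  have h4 := h3.const_mul (1 / 2 : ℂ)
  rw [show (1 / 2 : ℂ) * (2 * Complex.cos (Real.pi * z)) = Complex.cos (Real.pi * z) by ring] at h4
  refine h4.congr' ?_
  have hne : ∀ᶠ n : ℕ in atTop, (Real.pi * z * ∏ j ∈ Finset.range n, (1 - z ^ 2 / ((j : ℂ) + 1) ^ 2)) ≠ 0 :=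
    h1.eventually_ne hz
  filter_upwards [hne] with n hn
  simp only [Function.comp_apply, id_eq, Pi.div_apply]
  rw [prod_range_two_mul]
  have e1 : ∏ j ∈ Finset.range n, (1 - (2 * z) ^ 2 / (((2 * j + 1 : ℕ) : ℂ) + 1) ^ 2) =
      ∏ j ∈ Finset.range n, (1 - z ^ 2 / ((j : ℂ) + 1) ^ 2) := by
    refine Finset.prod_congr rfl fun j _ => ?_
    have : (j : ℂ) + 1 ≠ 0 := Nat.cast_add_one_ne_zero j
    push_cast
    rw [show 2 * (j : ℂ) + 1 + 1 = 2 * (j + 1) by ring]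
    field_simp
  have e2 : ∏ j ∈ Finset.range n, (1 - (2 * z) ^ 2 / (((2 * j : ℕ) : ℂ) + 1) ^ 2) =
      ∏ j ∈ Finset.range n, (1 - 4 * z ^ 2 / (2 * (j : ℂ) + 1) ^ 2) := by
    refine Finset.prod_congr rfl fun j _ => ?_
    push_cast
    ring
  rw [e1, e2]
  have hn' := right_ne_zero_of_mul hn
  generalize ∏ j ∈ Finset.range n, (1 - z ^ 2 / ((j : ℂ) + 1) ^ 2) = p at hn'
  generalize ∏ j ∈ Finset.range n, (1 - 4 * z ^ 2 / (2 * (j : ℂ) + 1) ^ 2) = q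
  field_simp

/-- The cosine product at `z = i c / (2π)`. There `sin πz` vanishes when `c = 0`, hence the separate
case. -/
theorem tendsto_prod_cosh (c : ℝ) :
    Tendsto (fun n => ∏ r ∈ Finset.range n, (1 + c ^ 2 / 2 * pgCoeff 0 r)) atTop
      (𝓝 (Real.cosh (c / 2))) := by
  rcases eq_or_ne c 0 with rfl | hc
  · simp
  have hpi : (Real.pi : ℂ) ≠ 0 := by exact_mod_cast Real.pi_ne_zero
  have harg : (Real.pi : ℂ) * (c * Complex.I / (2 * Real.pi)) = ((c / 2 : ℝ) : ℂ) * Complex.I := by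
    push_cast; field_simp
  have hsin : Complex.sin (Real.pi * (c * Complex.I / (2 * Real.pi))) ≠ 0 := by
    rw [harg, Complex.sin_mul_I, ← Complex.ofReal_sinh]
    refine mul_ne_zero ?_ Complex.I_ne_zero
    exact_mod_cast Real.sinh_ne_zero.mpr (div_ne_zero hc two_ne_zero)
  have h := tendsto_euler_cos_prod hsin
  rw [harg, Complex.cos_mul_I, ← Complex.ofReal_cosh] at h
  rw [← Filter.tendsto_ofReal_iff]
  refine h.congr fun n => ?_
  rw [Complex.ofReal_prod]
  refine Finset.prod_congr rfl fun j _ => ?_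
  have hj : 2 * (j : ℂ) + 1 ≠ 0 := by exact_mod_cast (2 * j).succ_ne_zero
  have hj' : (j : ℂ) + 1 / 2 ≠ 0 := by
    intro h0; apply hj; linear_combination 2 * h0
  unfold pgCoeff
  push_cast
  rw [show (2 * (j : ℂ) + 1) = 2 * (j + 1 / 2) by ring]
  simp only [ne_eq, OfNat.ofNat_ne_zero, not_false_eq_true, zero_pow, zero_div, add_zero]
  generalize hw : (j : ℂ) + 1 / 2 = w at hj'
  field_simp
  rw [Complex.I_sq]
  ring

theorem mgf_polyaGamma_zero (c : ℝ) :
    mgf id (polyaGamma 1 0) (-(c ^ 2 / 2)) = (Real.cosh (c / 2))⁻¹ := by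
  obtain ⟨ε, hε, hr, hint⟩ := exists_integrable_exp_polyaGammaSeries 0
  have h1 := tendsto_prod_mgf_polyaGamma hε.le hr hint (t := -(c ^ 2 / 2))
    (by nlinarith [sq_nonneg c])
  refine tendsto_nhds_unique h1 (((tendsto_prod_cosh c).inv₀ (Real.cosh_pos _).ne').congr fun n => ?_)
  rw [← Finset.prod_inv_distrib]
  refine Finset.prod_congr rfl fun r _ => ?_
  ring

/-- The identity holds factor by factor because `1 / pgCoeff c r = 1 / pgCoeff 0 r + c² / 2`; the
surplus factors `1 + c² / 2 * pgCoeff 0 r` multiply to `cosh (c/2)`. -/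
theorem exists_mgf_polyaGamma_eq (c : ℝ) :
    ∃ ε > 0, Integrable (fun w => Real.exp (ε * w)) (polyaGamma 1 c) ∧
      Integrable (fun w => Real.exp (ε * w)) (polyaGamma 1 0) ∧ ∀ t ≤ ε,
      mgf id (polyaGamma 1 c) t =
        Real.cosh (c / 2) * mgf id (polyaGamma 1 0) (t - c ^ 2 / 2) := by
  obtain ⟨ε₀, hε₀, hr₀, hint₀⟩ := exists_integrable_exp_polyaGammaSeries 0
  obtain ⟨ε₁, hε₁, hr₁, hint₁⟩ := exists_integrable_exp_polyaGammaSeries c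
  have key (a d : ℝ) (ha : Integrable (fun γ => Real.exp (a * polyaGammaSeries γ d)) gammaSeq)
      (b : ℝ) (hb : b ≤ a) : Integrable (fun w => Real.exp (b * w)) (polyaGamma 1 d) := by
    have hm := measurable_polyaGammaSeries_left d
    rw [polyaGamma, integrable_map_measure (by fun_prop) hm.aemeasurable]
    refine ha.mono' (by fun_prop) ?_
    filter_upwards [ae_nonneg_polyaGammaSeries d] with γ hγ
    simp only [Function.comp_apply]
    rw [Real.norm_of_nonneg (Real.exp_pos _).le, Real.exp_le_exp]
    exact mul_le_mul_of_nonneg_right hb hγ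
  refine ⟨min ε₀ ε₁, lt_min hε₀ hε₁, key _ _ hint₁ _ (min_le_right _ _),
    key _ _ hint₀ _ (min_le_left _ _), fun t ht => ?_⟩
  have h1 := tendsto_prod_mgf_polyaGamma hε₁.le hr₁ hint₁ (ht.trans (min_le_right _ _))
  have h2 := tendsto_prod_mgf_polyaGamma hε₀.le hr₀ hint₀ (t := t - c ^ 2 / 2)
    (by nlinarith [sq_nonneg c, ht.trans (min_le_left _ _)])
  refine tendsto_nhds_unique h1 (((tendsto_prod_cosh c).mul h2).congr fun n => ?_)
  rw [← Finset.prod_mul_distrib]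
  refine Finset.prod_congr rfl fun r _ => ?_
  have hlt : t * pgCoeff c r < 1 :=
    (mul_le_mul_of_nonneg_right (ht.trans (min_le_right _ _)) (pgCoeff_pos c r).le).trans_lt (hr₁ r)
  have hlt0 : (t - c ^ 2 / 2) * pgCoeff 0 r < 1 :=
    (mul_le_mul_of_nonneg_right (by nlinarith [sq_nonneg c, ht.trans (min_le_left _ _)])
      (pgCoeff_pos 0 r).le).trans_lt (hr₀ r)
  rw [← div_eq_mul_inv, div_eq_iff (by linarith), eq_comm, inv_mul_eq_div, div_eq_iff (by linarith)]
  have hpi := Real.pi_pos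
  unfold pgCoeff
  field_simp
  ring

/-! ### Exponential tilting of Pólya–Gamma laws -/

/-- Two probability measures on `ℝ` whose moment generating functions are finite and agree near `0`
are equal. -/
theorem ext_of_mgf_eq_nhds {μ ν : Measure ℝ} [IsProbabilityMeasure μ] [IsProbabilityMeasure ν]
    {s : Set ℝ} (hs : IsOpen s) (hconv : Convex ℝ s) (h0 : (0 : ℝ) ∈ s)
    (hμ : s ⊆ integrableExpSet id μ) (hν : s ⊆ integrableExpSet id ν)
    (h : ∀ t ∈ s, mgf id μ t = mgf id ν t) : μ = ν := by
  have hX : AnalyticOnNhd ℂ (complexMGF id μ) {z | z.re ∈ s} :=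
    analyticOnNhd_complexMGF.mono fun z hz => interior_maximal hμ hs hz
  have hY : AnalyticOnNhd ℂ (complexMGF id ν) {z | z.re ∈ s} :=
    analyticOnNhd_complexMGF.mono fun z hz => interior_maximal hν hs hz
  -- Identity theorem on the vertical strip over `s`, connected by convexity: the functions agree at
  -- real points accumulating at 0. The imaginary axis lies in the strip and carries the
  -- characteristic functions.
  have heq : EqOn (complexMGF id μ) (complexMGF id ν) {z | z.re ∈ s} := by
    refine AnalyticOnNhd.eqOn_of_preconnected_of_frequently_eq hX hY
      (hconv.linear_preimage Complex.reLm).isPreconnected (z₀ := 0) (by simpa using h0) ?_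
    have h_real : ∃ᶠ x : ℝ in 𝓝[≠] 0, complexMGF id μ x = complexMGF id ν x := by
      refine Eventually.frequently ?_
      filter_upwards [nhdsWithin_le_nhds (hs.mem_nhds h0)] with x hx
      rw [complexMGF_ofReal, complexMGF_ofReal, h x hx]
    have ht : Tendsto (fun x : ℝ => (x : ℂ)) (𝓝[≠] 0) (𝓝[≠] 0) := by
      refine tendsto_nhdsWithin_iff.mpr ⟨?_, ?_⟩
      · exact (Complex.continuous_ofReal.tendsto' 0 0 Complex.ofReal_zero).mono_left
          nhdsWithin_le_nhds
      · filter_upwards [self_mem_nhdsWithin] with x hx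
        simpa using hx
    exact ht.frequently h_real
  refine Measure.ext_of_charFun ?_
  ext t
  rw [← complexMGF_id_mul_I, ← complexMGF_id_mul_I]
  exact heq (by simpa using h0)

theorem mgf_withDensity_polyaGamma (c t : ℝ) :
    mgf id ((polyaGamma 1 0).withDensity fun w =>
      ENNReal.ofReal (Real.cosh (c / 2) * Real.exp (-(c ^ 2 / 2) * w))) t =
      Real.cosh (c / 2) * mgf id (polyaGamma 1 0) (t - c ^ 2 / 2) := by
  have hc := Real.cosh_pos (c / 2)
  rw [mgf, integral_withDensity_eq_integral_toReal_smul (by fun_prop)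
    (Eventually.of_forall fun _ => ENNReal.ofReal_lt_top), mgf, ← integral_const_mul]
  congr 1 with w
  rw [ENNReal.toReal_ofReal (by positivity), smul_eq_mul, mul_assoc, ← Real.exp_add]
  simp only [id_eq]
  ring_nf

/-- Both sides have the same finite Laplace transform on a half-line containing a neighbourhood of
0. -/
theorem polyaGamma_eq_withDensity (c : ℝ) :
    polyaGamma 1 c = (polyaGamma 1 0).withDensity fun w =>
      ENNReal.ofReal (Real.cosh (c / 2) * Real.exp (-(c ^ 2 / 2) * w)) := by
  have hc := Real.cosh_pos (c / 2)
  obtain ⟨ε, hε, h1, h0, h⟩ := exists_mgf_polyaGamma_eq c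
  set ν := (polyaGamma 1 0).withDensity fun w =>
      ENNReal.ofReal (Real.cosh (c / 2) * Real.exp (-(c ^ 2 / 2) * w)) with hν
  have hmono (d : ℝ) (hd : Integrable (fun w => Real.exp (ε * w)) (polyaGamma 1 d)) (t : ℝ)
      (ht : t ≤ ε) : Integrable (fun w => Real.exp (t * w)) (polyaGamma 1 d) := by
    refine hd.mono' (by fun_prop) ?_
    filter_upwards [ae_nonneg_polyaGamma d] with w hw
    rw [Real.norm_of_nonneg (Real.exp_pos _).le, Real.exp_le_exp]
    exact mul_le_mul_of_nonneg_right ht hw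
  have hint (t : ℝ) (ht : t ≤ ε) : Integrable (fun w => Real.exp (t * w)) ν := by
    rw [hν, integrable_withDensity_iff_integrable_smul' (by fun_prop)
      (Eventually.of_forall fun _ => ENNReal.ofReal_lt_top)]
    refine ((hmono 0 h0 (t - c ^ 2 / 2) (by nlinarith [sq_nonneg c])).const_mul
      (Real.cosh (c / 2))).congr (Eventually.of_forall fun w => ?_)
    simp only [smul_eq_mul]
    rw [ENNReal.toReal_ofReal (by positivity), mul_assoc, ← Real.exp_add]
    ring_nf
  -- The total mass is the transform at `t = 0`, where the identity gives 1.
  have hprob : IsProbabilityMeasure ν := by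
    have hi := hint 0 hε.le
    simp only [zero_mul, Real.exp_zero] at hi
    have : IsFiniteMeasure ν := by
      rcases integrable_const_iff.mp hi with h | h
      · simp at h
      · exact ⟨h.measure_univ_lt_top⟩
    have hm := mgf_withDensity_polyaGamma c 0
    rw [← hν, ← h 0 hε.le, mgf_zero', mgf_zero, measureReal_def, ENNReal.toReal_eq_one_iff] at hm
    exact ⟨hm⟩
  refine ext_of_mgf_eq_nhds (s := Iio ε) isOpen_Iio (convex_Iio ε) hε (fun t ht => ?_) (fun t ht => ?_)
    fun t ht => ?_
  · exact hmono c h1 t (le_of_lt ht)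
  · exact hint t (le_of_lt ht)
  · rw [hν, mgf_withDensity_polyaGamma, h t (le_of_lt ht)]

theorem exists_integrable_exp_abs_polyaGamma (c : ℝ) :
    ∃ ε > 0, Integrable (fun w => Real.exp (ε * |w|)) (polyaGamma 1 c) := by
  obtain ⟨ε, hε, h1, -⟩ := exists_mgf_polyaGamma_eq c
  refine ⟨ε, hε, h1.congr ?_⟩
  filter_upwards [ae_nonneg_polyaGamma c] with w hw
  rw [abs_of_nonneg hw]

theorem Iio_subset_integrableExpSet_polyaGamma :
    ∃ ε > 0, Iio ε ⊆ integrableExpSet id (polyaGamma 1 0) := by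
  obtain ⟨ε, hε, h1, -⟩ := exists_mgf_polyaGamma_eq 0
  refine ⟨ε, hε, fun t ht => ?_⟩
  refine h1.mono' (by fun_prop) ?_
  filter_upwards [ae_nonneg_polyaGamma 0] with w hw
  rw [Real.norm_of_nonneg (Real.exp_pos _).le, Real.exp_le_exp]
  exact mul_le_mul_of_nonneg_right (le_of_lt ht) hw

/-- Differentiate `mgf (-c²/2) = 1 / cosh (c/2)` in `c`: the chain rule brings out a factor `c`,
which is divided away. -/
theorem integral_mul_exp_polyaGamma (c : ℝ) :
    ∫ w, w * Real.exp (-(c ^ 2 / 2) * w) ∂(polyaGamma 1 0) =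
      polyaGammaMean 1 c / Real.cosh (c / 2) := by
  obtain ⟨ε, hε, hsub⟩ := Iio_subset_integrableExpSet_polyaGamma
  have hint {t : ℝ} (ht : t < ε) : t ∈ interior (integrableExpSet id (polyaGamma 1 0)) :=
    interior_maximal hsub isOpen_Iio ht
  set D : ℝ → ℝ := fun t => ∫ w, w * Real.exp (t * w) ∂(polyaGamma 1 0) with hD
  have hneg (c : ℝ) : -(c ^ 2 / 2) < ε := by nlinarith [sq_nonneg c]
  have hderiv (c : ℝ) : D (-(c ^ 2 / 2)) * c = Real.sinh (c / 2) / Real.cosh (c / 2) ^ 2 * (1 / 2) := by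
    have h1 : HasDerivAt (fun c : ℝ => mgf id (polyaGamma 1 0) (-(c ^ 2 / 2)))
        (D (-(c ^ 2 / 2)) * (-c)) c := by
      have := (((hasDerivAt_id c).fun_pow 2).div_const 2).fun_neg
      convert HasDerivAt.comp c (h₂ := mgf id (polyaGamma 1 0)) (hasDerivAt_mgf (hint (hneg c)))
        this using 2
      iterate 4 · rfl
      simp
    have h2 : HasDerivAt (fun c : ℝ => (Real.cosh (c / 2))⁻¹)
        (-(Real.sinh (c / 2) * (1 / 2)) / Real.cosh (c / 2) ^ 2) c :=
      (((hasDerivAt_id c).div_const 2).cosh).inv (Real.cosh_pos _).ne'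
    have h3 := h1.unique (h2.congr_of_eventuallyEq (Eventually.of_forall mgf_polyaGamma_zero))
    linear_combination -h3
  have hne {c : ℝ} (hc : c ≠ 0) : D (-(c ^ 2 / 2)) =
      (Real.sinh (c / 2) / c) / Real.cosh (c / 2) ^ 2 * (1 / 2) := by
    rw [eq_comm, div_div, mul_comm c, ← div_div, div_mul_eq_mul_div, ← hderiv c, mul_div_assoc,
      div_self hc, mul_one]
  change D (-(c ^ 2 / 2)) = _
  have hcosh := Real.cosh_pos (c / 2)
  rcases eq_or_ne c 0 with rfl | hc
  -- At `c = 0` the differentiated identity reads `0 = 0`; the value is recovered as a limit, by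
  -- continuity of `D`.
  · have hcont : ContinuousAt D 0 := by
      have := (hasDerivAt_integral_pow_mul_exp_real (X := id) (μ := polyaGamma 1 0) (hint hε) 1).continuousAt
      simpa [hD] using this
    have hl : Tendsto (fun c : ℝ => D (-(c ^ 2 / 2))) (𝓝[≠] 0) (𝓝 (D 0)) := by
      refine hcont.tendsto.comp (Tendsto.mono_left ?_ nhdsWithin_le_nhds)
      exact Continuous.tendsto' (by fun_prop) _ _ (by simp)
    have hslope : Tendsto (fun c : ℝ => Real.sinh (c / 2) / c) (𝓝[≠] 0) (𝓝 (1 / 2)) := by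
      have h2 : HasDerivAt (fun c : ℝ => Real.sinh (c / 2)) (Real.cosh (0 / 2) * (1 / 2)) 0 :=
        ((hasDerivAt_id (0 : ℝ)).div_const 2).sinh
      have := h2.tendsto_slope
      simp only [zero_div, Real.cosh_zero, one_mul] at this
      refine this.congr fun x => ?_
      simp [slope_def_field]
    have hr : Tendsto (fun c : ℝ => (Real.sinh (c / 2) / c) / Real.cosh (c / 2) ^ 2 * (1 / 2))
        (𝓝[≠] 0) (𝓝 (1 / 2 / 1 * (1 / 2))) := by
      refine (hslope.div (Tendsto.mono_left ?_ nhdsWithin_le_nhds) one_ne_zero).mul_const _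
      exact Continuous.tendsto' (by fun_prop) _ _ (by simp)
    have := tendsto_nhds_unique hl (hr.congr' (by
      filter_upwards [self_mem_nhdsWithin] with c hc
      exact (hne hc).symm))
    simp only [ne_eq, OfNat.ofNat_ne_zero, not_false_eq_true, zero_pow, zero_div, neg_zero, this,
      polyaGammaMean, Real.cosh_zero, if_true]
    norm_num
  · rw [hne hc, polyaGammaMean, if_neg hc]
    have h1 : (Real.exp c - 1) / (Real.exp c + 1) = Real.sinh (c / 2) / Real.cosh (c / 2) := by
      have he : Real.exp c = Real.exp (c / 2) ^ 2 := by
        rw [← Real.exp_nat_mul]; congr 1; push_cast; ring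
      rw [Real.sinh_eq, Real.cosh_eq, Real.exp_neg, he]
      have := Real.exp_pos (c / 2)
      field_simp
    rw [h1]
    field_simp

theorem integral_id_polyaGamma (c : ℝ) : ∫ w, w ∂(polyaGamma 1 c) = polyaGammaMean 1 c := by
  have hc := Real.cosh_pos (c / 2)
  rw [polyaGamma_eq_withDensity, integral_withDensity_eq_integral_toReal_smul (by fun_prop)
    (Eventually.of_forall fun _ => ENNReal.ofReal_lt_top)]
  have (w : ℝ) : (ENNReal.ofReal (Real.cosh (c / 2) * Real.exp (-(c ^ 2 / 2) * w))).toReal • w =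
      Real.cosh (c / 2) * (w * Real.exp (-(c ^ 2 / 2) * w)) := by
    rw [ENNReal.toReal_ofReal (by positivity), smul_eq_mul]; ring
  simp_rw [this]
  rw [integral_const_mul, integral_mul_exp_polyaGamma]
  field_simp

/-! ### Relative entropy and exponential integrability -/

section Entropy

variable {𝒳 𝒵 : Type*} [MeasurableSpace 𝒳] [MeasurableSpace 𝒵]

/-- Some exponential moment of `n` is finite. -/
def ExpIntegrable (n : 𝒳 → ℝ) (α : Measure 𝒳) : Prop :=
  ∃ ε > 0, Integrable (fun x => Real.exp (ε * n x)) α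

/-- The measure with density `exp h` with respect to `α`. -/
abbrev withExpDensity (α : Measure 𝒳) (h : 𝒳 → ℝ) : Measure 𝒳 :=
  α.withDensity fun x => ENNReal.ofReal (Real.exp (h x))

theorem absolutelyContinuous_withExpDensity {α : Measure 𝒳} {h : 𝒳 → ℝ} (hh : Measurable h) :
    α ≪ withExpDensity α h :=
  withDensity_absolutelyContinuous' (by fun_prop)
    (Eventually.of_forall fun x => by simp [Real.exp_pos])

instance {α : Measure 𝒳} [SigmaFinite α] {h : 𝒳 → ℝ} : SigmaFinite (withExpDensity α h) :=
  SigmaFinite.withDensity_ofReal _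

theorem ae_toReal_rnDeriv_pos {μ α : Measure 𝒳} [SigmaFinite μ] [SigmaFinite α] (hac : μ ≪ α) :
    ∀ᵐ x ∂μ, 0 < (μ.rnDeriv α x).toReal := by
  filter_upwards [Measure.rnDeriv_pos hac, hac.ae_le (Measure.rnDeriv_lt_top μ α)] with x h0 h1
  exact ENNReal.toReal_pos h0.ne' h1.ne

theorem llr_withExpDensity {μ α : Measure 𝒳} [SigmaFinite μ] [SigmaFinite α] (hac : μ ≪ α)
    {h : 𝒳 → ℝ} (hh : Measurable h) :
    llr μ (withExpDensity α h) =ᵐ[μ] fun x => llr μ α x - h x := by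
  have h1 := hac.ae_le (Measure.rnDeriv_withDensity_right μ α
    (f := fun x => ENNReal.ofReal (Real.exp (h x))) (by fun_prop)
    (Eventually.of_forall fun x => by simp [Real.exp_pos])
    (Eventually.of_forall fun x => ENNReal.ofReal_ne_top))
  filter_upwards [h1, ae_toReal_rnDeriv_pos hac] with x hx hpos
  rw [llr, hx, ENNReal.toReal_mul, ENNReal.toReal_inv, ENNReal.toReal_ofReal (Real.exp_pos _).le,
    Real.log_mul (by positivity) hpos.ne', Real.log_inv, Real.log_exp, llr]
  ring

/-- Where the log-ratio is at most `C + 2ε/3 * n`, the density times `n` is at most a multiple of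
`exp (ε n)`, integrable under `α`. Elsewhere the upper bound `hle` forces `ε/3 * n < r`. Only an
upper bound on the log-ratio is required, since on a slice of a product its integrability is not yet
known. -/
theorem integrable_of_llr_le {μ α : Measure 𝒳} [SigmaFinite μ] [SigmaFinite α] (hac : μ ≪ α)
    {n : 𝒳 → ℝ} (hn : Measurable n) (hn0 : ∀ x, 0 ≤ n x) {ε C : ℝ} (hε : 0 < ε)
    (hexp : Integrable (fun x => Real.exp (ε * n x)) α) {r : 𝒳 → ℝ} (hr : Integrable r μ)
    (hle : ∀ᵐ x ∂μ, llr μ α x ≤ r x + C + ε / 3 * n x) : Integrable n μ := by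
  set S : Set 𝒳 := {x | llr μ α x ≤ C + 2 * ε / 3 * n x} with hS
  have hSm : MeasurableSet S := measurableSet_le (measurable_llr μ α) (by fun_prop)
  have hind : Integrable (S.indicator n) μ := by
    refine ⟨(hn.indicator hSm).aestronglyMeasurable, ?_⟩
    rw [hasFiniteIntegral_iff_ofReal (Eventually.of_forall fun x => indicator_nonneg
      (fun y _ => hn0 y) x), ← lintegral_rnDeriv_mul hac
      (hn.indicator hSm).ennreal_ofReal.aemeasurable]
    refine lt_of_le_of_lt ?_ (hexp.const_mul (Real.exp C * (3 / ε))).lintegral_lt_top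
    refine lintegral_mono_ae ?_
    filter_upwards [Measure.rnDeriv_lt_top μ α] with x hx
    by_cases hxS : x ∈ S
    · rw [indicator_of_mem hxS]
      have hd : (μ.rnDeriv α x).toReal ≤ Real.exp (C + 2 * ε / 3 * n x) := by
        rcases (ENNReal.toReal_nonneg (a := μ.rnDeriv α x)).eq_or_lt with h0 | h0
        · rw [← h0]; positivity
        · rw [← Real.exp_log h0, Real.exp_le_exp]
          exact hxS
      rw [← ENNReal.ofReal_toReal hx.ne, ← ENNReal.ofReal_mul ENNReal.toReal_nonneg]
      refine ENNReal.ofReal_le_ofReal ?_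
      have h1 : n x ≤ 3 / ε * Real.exp (ε / 3 * n x) := by
        rw [div_mul_eq_mul_div, le_div_iff₀ hε]
        linarith [Real.add_one_le_exp (ε / 3 * n x)]
      calc (μ.rnDeriv α x).toReal * n x
          ≤ Real.exp (C + 2 * ε / 3 * n x) * (3 / ε * Real.exp (ε / 3 * n x)) := by
            gcongr; exact hn0 x
        _ = Real.exp C * (3 / ε) * Real.exp (ε * n x) := by
            rw [Real.exp_add, show ε * n x = 2 * ε / 3 * n x + ε / 3 * n x by ring, Real.exp_add]
            ring
    · simp [indicator_of_notMem hxS]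
  refine ((hr.abs.const_mul (3 / ε)).add hind).mono' hn.aestronglyMeasurable ?_
  filter_upwards [hle] with x hx
  rw [Real.norm_of_nonneg (hn0 x)]
  simp only [Pi.add_apply]
  have habs := le_abs_self (r x)
  by_cases hxS : x ∈ S
  · rw [indicator_of_mem hxS]
    have : 0 ≤ 3 / ε * |r x| := by positivity
    linarith
  · rw [indicator_of_notMem hxS, add_zero, div_mul_eq_mul_div, le_div_iff₀ hε]
    have : C + 2 * ε / 3 * n x < llr μ α x := not_le.mp hxS
    linarith

theorem integrable_of_klDiv_ne_top {μ α : Measure 𝒳} [SigmaFinite μ] [SigmaFinite α]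
    {n : 𝒳 → ℝ} (hn : Measurable n) (hn0 : ∀ x, 0 ≤ n x) (hexp : ExpIntegrable n α)
    (h : klDiv μ α ≠ ⊤) : Integrable n μ := by
  obtain ⟨ε, hε, he⟩ := hexp
  obtain ⟨hac, hint⟩ := klDiv_ne_top_iff.mp h
  refine integrable_of_llr_le hac hn hn0 hε he hint (C := 0) (Eventually.of_forall fun x => ?_)
  have := mul_nonneg hε.le (hn0 x)
  linarith

/-- Changing the reference subtracts `h` from the log-ratio. Integrability of `h` must be available
from finiteness of either entropy, hence exponential moments under both references. -/
theorem klDiv_withExpDensity {α : Measure 𝒳} [IsProbabilityMeasure α] {h n : 𝒳 → ℝ}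
    (hh : Measurable h) (hn : Measurable n) (hn0 : ∀ x, 0 ≤ n x) {C : ℝ}
    (hhn : ∀ x, |h x| ≤ C * (1 + n x)) (he : ExpIntegrable n α)
    [IsProbabilityMeasure (withExpDensity α h)] (he' : ExpIntegrable n (withExpDensity α h))
    (μ : Measure 𝒳) [IsProbabilityMeasure μ] :
    (klDiv μ (withExpDensity α h) ≠ ⊤ ↔ klDiv μ α ≠ ⊤) ∧
    (klDiv μ α ≠ ⊤ → (klDiv μ (withExpDensity α h)).toReal = (klDiv μ α).toReal - ∫ x, h x ∂μ) := by
  have hint (hi : Integrable n μ) : Integrable h μ :=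
    (((integrable_const 1).add hi).const_mul C).mono' hh.aestronglyMeasurable
      (Eventually.of_forall hhn)
  have hac' := absolutelyContinuous_withExpDensity (α := α) hh
  have hfwd (hk : klDiv μ α ≠ ⊤) : μ ≪ withExpDensity α h ∧ Integrable h μ ∧
      Integrable (llr μ α) μ ∧ Integrable (llr μ (withExpDensity α h)) μ := by
    have hi := hint (integrable_of_klDiv_ne_top hn hn0 he hk)
    obtain ⟨h1, h2⟩ := klDiv_ne_top_iff.mp hk
    exact ⟨h1.trans hac', hi, h2, (h2.sub hi).congr (llr_withExpDensity h1 hh).symm⟩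
  refine ⟨⟨fun hk => ?_, fun hk => ?_⟩, fun hk => ?_⟩
  · have hi := hint (integrable_of_klDiv_ne_top hn hn0 he' hk)
    obtain ⟨h1, h2⟩ := klDiv_ne_top_iff.mp hk
    have h3 := h1.trans (withDensity_absolutelyContinuous _ _)
    refine klDiv_ne_top h3 ((h2.add hi).congr ?_)
    filter_upwards [llr_withExpDensity h3 hh] with x hx
    simp [hx]
  · obtain ⟨h1, -, -, h4⟩ := hfwd hk
    exact klDiv_ne_top h1 h4
  · obtain ⟨h1, h2, h3, h4⟩ := hfwd hk
    have h5 := (klDiv_ne_top_iff.mp hk).1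
    rw [toReal_klDiv_of_measure_eq h1 (by simp), toReal_klDiv_of_measure_eq h5 (by simp),
      integral_congr_ae (llr_withExpDensity h5 hh), integral_sub h3 h2]

theorem absolutelyContinuous_of_prod {μ α : Measure 𝒳} {ν β : Measure 𝒵} [IsProbabilityMeasure μ]
    [IsProbabilityMeasure ν] [IsProbabilityMeasure α] [IsProbabilityMeasure β]
    (h : μ.prod ν ≪ α.prod β) : μ ≪ α ∧ ν ≪ β := by
  have h1 := h.map measurable_fst
  have h2 := h.map measurable_snd
  simpa using And.intro h1 h2

theorem llr_prod {μ α : Measure 𝒳} {ν β : Measure 𝒵} [IsProbabilityMeasure μ]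
    [IsProbabilityMeasure ν] [IsProbabilityMeasure α] [IsProbabilityMeasure β]
    (h1 : μ ≪ α) (h2 : ν ≪ β) :
    llr (μ.prod ν) (α.prod β) =ᵐ[μ.prod ν] fun p => llr μ α p.1 + llr ν β p.2 := by
  have heq : μ.prod ν =
      (α.prod β).withDensity (fun p => μ.rnDeriv α p.1 * ν.rnDeriv β p.2) := by
    rw [← prod_withDensity (Measure.measurable_rnDeriv μ α) (Measure.measurable_rnDeriv ν β),
      Measure.withDensity_rnDeriv_eq _ _ h1, Measure.withDensity_rnDeriv_eq _ _ h2]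
  have hd := Measure.rnDeriv_withDensity (α.prod β)
    (f := fun p : 𝒳 × 𝒵 => μ.rnDeriv α p.1 * ν.rnDeriv β p.2)
    (((Measure.measurable_rnDeriv μ α).comp measurable_fst).mul
      ((Measure.measurable_rnDeriv ν β).comp measurable_snd))
  rw [← heq] at hd
  filter_upwards [(h1.prod h2).ae_le hd,
    Measure.quasiMeasurePreserving_fst.ae (ae_toReal_rnDeriv_pos h1),
    Measure.quasiMeasurePreserving_snd.ae (ae_toReal_rnDeriv_pos h2)] with p hp hp1 hp2
  rw [llr, hp, ENNReal.toReal_mul, Real.log_mul hp1.ne' hp2.ne']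
  rfl

variable {J : Type*} [Fintype J]

/-- The log-ratio is `llr μ α + llr ν β - u + ∑ f g`. The difficulty is to recover two finite
entropies from integrability of this sum, where cancellation is conceivable; the sign of the cross
terms excludes it. -/
theorem klDiv_prod_withExpDensity {α : Measure 𝒳} {β : Measure 𝒵} [IsProbabilityMeasure α]
    [IsProbabilityMeasure β] {u n : 𝒳 → ℝ} {f : J → 𝒳 → ℝ} {g : J → 𝒵 → ℝ} {n' : 𝒵 → ℝ}
    (hu : Measurable u) (hn : Measurable n) (hn0 : ∀ x, 0 ≤ n x) (hn' : Measurable n')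
    (hn0' : ∀ z, 0 ≤ n' z) (hf : ∀ j, Measurable (f j)) (hg : ∀ j, Measurable (g j))
    (hun : ∀ δ > 0, ∃ C, ∀ x, |u x| ≤ C + δ * n x) (hf0 : ∀ j x, 0 ≤ f j x) {C : ℝ}
    (hfn : ∀ j x, f j x ≤ C * n x) (hg0 : ∀ j, ∀ᵐ z ∂β, 0 ≤ g j z) (hgn : ∀ j z, |g j z| ≤ n' z)
    (he : ExpIntegrable n α) (he' : ExpIntegrable n' β)
    {ψ : 𝒳 × 𝒵 → ℝ} (hψ : ψ = fun p => u p.1 - ∑ j, f j p.1 * g j p.2)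
    (μ : Measure 𝒳) (ν : Measure 𝒵) [IsProbabilityMeasure μ] [IsProbabilityMeasure ν] :
    (klDiv (μ.prod ν) (withExpDensity (α.prod β) ψ) ≠ ⊤ ↔ klDiv μ α ≠ ⊤ ∧ klDiv ν β ≠ ⊤) ∧
    (klDiv μ α ≠ ⊤ → klDiv ν β ≠ ⊤ →
      ∫ p, llr (μ.prod ν) (withExpDensity (α.prod β) ψ) p ∂(μ.prod ν) =
        (klDiv μ α).toReal + (klDiv ν β).toReal - ∫ x, u x ∂μ
          + ∑ j, (∫ x, f j x ∂μ) * ∫ z, g j z ∂ν) := by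
  have hψm : Measurable ψ := by rw [hψ]; fun_prop
  have hllr (h1 : μ ≪ α) (h2 : ν ≪ β) :
      llr (μ.prod ν) (withExpDensity (α.prod β) ψ) =ᵐ[μ.prod ν]
        fun p => llr μ α p.1 + llr ν β p.2 - u p.1 + ∑ j, f j p.1 * g j p.2 := by
    filter_upwards [llr_withExpDensity (h1.prod h2) hψm, llr_prod h1 h2] with p hp hp'
    rw [hp, hp', hψ]
    ring
  have hui (hi : Integrable n μ) : Integrable u μ := by
    obtain ⟨D, hD⟩ := hun 1 one_pos
    exact ((integrable_const D).add (hi.const_mul 1)).mono' hu.aestronglyMeasurable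
      (Eventually.of_forall hD)
  have hfi (hi : Integrable n μ) (j : J) : Integrable (f j) μ :=
    (hi.const_mul C).mono' (hf j).aestronglyMeasurable (Eventually.of_forall fun x => by
      rw [Real.norm_of_nonneg (hf0 j x)]; exact hfn j x)
  have hgi (hi : Integrable n' ν) (j : J) : Integrable (g j) ν :=
    hi.mono' (hg j).aestronglyMeasurable (Eventually.of_forall fun z => hgn j z)
  have hsum (hi : Integrable n μ) (hi' : Integrable n' ν) :
      Integrable (fun p : 𝒳 × 𝒵 => ∑ j, f j p.1 * g j p.2) (μ.prod ν) :=
    integrable_finsetSum _ fun j _ => (hfi hi j).mul_prod (hgi hi' j)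
  refine ⟨⟨fun hk => ?_, fun ⟨hk, hk'⟩ => ?_⟩, fun hk hk' => ?_⟩
  · obtain ⟨hac, hint⟩ := klDiv_ne_top_iff.mp hk
    obtain ⟨h1, h2⟩ := absolutelyContinuous_of_prod
      (hac.trans (withDensity_absolutelyContinuous _ _))
    have hint := hint.congr (hllr h1 h2)
    have hgν : ∀ᵐ z ∂ν, ∀ j, 0 ≤ g j z := ae_all_iff.mpr fun j => h2.ae_le (hg0 j)
    have hi : Integrable n μ := by
      -- By Fubini almost every slice is integrable. On one with `g j z ≥ 0`, dropping the cross
      -- terms bounds `llr μ α` from above, and `u` costs only `ε/3 * n`.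
      obtain ⟨z, hz, hgz⟩ := (hint.prod_left_ae.and hgν).exists
      obtain ⟨ε, hε, hee⟩ := he
      obtain ⟨D, hD⟩ := hun (ε / 3) (by positivity)
      refine integrable_of_llr_le h1 hn hn0 hε hee hz (C := D - llr ν β z)
        (Eventually.of_forall fun x => ?_)
      have hs : 0 ≤ ∑ j, f j x * g j z :=
        Finset.sum_nonneg fun j _ => mul_nonneg (hf0 j x) (hgz j)
      have := (le_abs_self (u x)).trans (hD x)
      linarith
    have hi' : Integrable n' ν := by
      obtain ⟨x, hx⟩ := hint.prod_right_ae.exists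
      obtain ⟨ε, hε, hee⟩ := he'
      refine integrable_of_llr_le h2 hn' hn0' hε hee hx (C := u x - llr μ α x) ?_
      filter_upwards [hgν] with z hgz
      have hs : 0 ≤ ∑ j, f j x * g j z :=
        Finset.sum_nonneg fun j _ => mul_nonneg (hf0 j x) (hgz j)
      have := mul_nonneg hε.le (hn0' z)
      linarith
    -- With both moments integrable, `u` and the cross terms can be removed; slicing the remaining
    -- sum leaves each log-ratio up to a constant.
    have hab : Integrable (fun p : 𝒳 × 𝒵 => llr μ α p.1 + llr ν β p.2) (μ.prod ν) := by
      refine ((hint.sub (hsum hi hi')).add ((hui hi).comp_fst ν)).congr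
        (Eventually.of_forall fun p => ?_)
      simp
    constructor
    · obtain ⟨z, hz⟩ := hab.prod_left_ae.exists
      exact klDiv_ne_top h1 ((hz.sub (integrable_const (llr ν β z))).congr
        (Eventually.of_forall fun x => by simp))
    · obtain ⟨x, hx⟩ := hab.prod_right_ae.exists
      exact klDiv_ne_top h2 ((hx.sub (integrable_const (llr μ α x))).congr
        (Eventually.of_forall fun z => by simp))
  · obtain ⟨h1, h3⟩ := klDiv_ne_top_iff.mp hk
    obtain ⟨h2, h4⟩ := klDiv_ne_top_iff.mp hk'
    have hi := integrable_of_klDiv_ne_top hn hn0 he hk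
    have hi' := integrable_of_klDiv_ne_top hn' hn0' he' hk'
    exact klDiv_ne_top ((h1.prod h2).trans (absolutelyContinuous_withExpDensity hψm))
      (((((h3.comp_fst ν).add (h4.comp_snd μ)).sub ((hui hi).comp_fst ν)).add
        (hsum hi hi')).congr (hllr h1 h2).symm)
  · obtain ⟨h1, h3⟩ := klDiv_ne_top_iff.mp hk
    obtain ⟨h2, h4⟩ := klDiv_ne_top_iff.mp hk'
    have hi := integrable_of_klDiv_ne_top hn hn0 he hk
    have hi' := integrable_of_klDiv_ne_top hn' hn0' he' hk'
    rw [integral_congr_ae (hllr h1 h2), integral_add, integral_sub, integral_add,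
      integral_finsetSum, integral_fun_fst, integral_fun_snd, integral_fun_fst,
      toReal_klDiv_of_measure_eq h1 (by simp), toReal_klDiv_of_measure_eq h2 (by simp)]
    · simp [integral_prod_mul]
    · exact fun j _ => (hfi hi j).mul_prod (hgi hi' j)
    · exact h3.comp_fst ν
    · exact h4.comp_snd μ
    · exact (h3.comp_fst ν).add (h4.comp_snd μ)
    · exact (hui hi).comp_fst ν
    · exact ((h3.comp_fst ν).add (h4.comp_snd μ)).sub ((hui hi).comp_fst ν)
    · exact hsum hi hi'

end Entropy

/-! ### Exponential densities of product measures -/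

section ExpDensity

variable {𝒳 𝒵 : Type*} [MeasurableSpace 𝒳] [MeasurableSpace 𝒵]

theorem withExpDensity_withExpDensity {α : Measure 𝒳} {h h' : 𝒳 → ℝ} (hh : Measurable h)
    (hh' : Measurable h') :
    withExpDensity (withExpDensity α h) h' = withExpDensity α (fun x => h x + h' x) := by
  rw [withExpDensity, withExpDensity, ← withDensity_mul _ (by fun_prop) (by fun_prop), withExpDensity]
  congr 1 with x
  rw [Pi.mul_apply, ← ENNReal.ofReal_mul (Real.exp_pos _).le, ← Real.exp_add]

theorem eq_withExpDensity_neg {α β : Measure 𝒳} {h : 𝒳 → ℝ} (hh : Measurable h)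
    (H : β = withExpDensity α h) : α = withExpDensity β (fun x => -h x) := by
  rw [H, withExpDensity_withExpDensity hh (h' := fun x => -h x) hh.neg]
  simp

theorem map_withExpDensity {α : Measure 𝒳} {e : 𝒳 → 𝒵} (he : Measurable e) {h : 𝒵 → ℝ}
    (hh : Measurable h) :
    (withExpDensity α (fun x => h (e x))).map e = withExpDensity (α.map e) h := by
  refine Measure.ext_of_lintegral _ fun φ hφ => ?_
  rw [lintegral_map hφ he, lintegral_withDensity_eq_lintegral_mul _ (by fun_prop) (by fun_prop),
    lintegral_withDensity_eq_lintegral_mul _ (by fun_prop) hφ, lintegral_map (by fun_prop) he]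
  rfl

/-- On a box the restricted density is a product of functions of single coordinates, which are
independent. -/
theorem pi_withExpDensity {ι : Type*} [Fintype ι] {E : ι → Type*} [∀ i, MeasurableSpace (E i)]
    (α : ∀ i, Measure (E i)) [∀ i, IsProbabilityMeasure (α i)] {h : ∀ i, E i → ℝ}
    (hh : ∀ i, Measurable (h i)) :
    Measure.pi (fun i => withExpDensity (α i) (h i)) =
      withExpDensity (Measure.pi α) (fun x => ∑ i, h i (x i)) := by
  refine Measure.pi_eq (μ := fun i => withExpDensity (α i) (h i)) fun s hs => ?_
  rw [withDensity_apply _ (MeasurableSet.univ_pi hs), ← lintegral_indicator (MeasurableSet.univ_pi hs)]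
  have hm (i : ι) : Measurable ((s i).indicator fun x => ENNReal.ofReal (Real.exp (h i x))) :=
    Measurable.indicator (by fun_prop) (hs i)
  have hind := iIndepFun_pi (μ := α)
    (X := fun i => (s i).indicator fun x => ENNReal.ofReal (Real.exp (h i x)))
    fun i => (hm i).aemeasurable
  have hprod := lintegral_prod_eq_prod_lintegral_of_indepFun Finset.univ _ hind
    fun i => (hm i).comp (measurable_pi_apply i)
  have hI (x : ∀ i, E i) : (Set.pi univ s).indicator
      (fun x => ENNReal.ofReal (Real.exp (∑ i, h i (x i)))) x =
      ∏ i, (s i).indicator (fun x => ENNReal.ofReal (Real.exp (h i x))) (x i) := by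
    by_cases hx : x ∈ Set.pi univ s
    · rw [indicator_of_mem hx, Real.exp_sum, ENNReal.ofReal_prod_of_nonneg fun i _ => (Real.exp_pos _).le]
      exact Finset.prod_congr rfl fun i _ => (indicator_of_mem (hx i (mem_univ i))
        (f := fun x => ENNReal.ofReal (Real.exp (h i x)))).symm
    · rw [indicator_of_notMem hx]
      simp only [Set.mem_pi, mem_univ, forall_const, not_forall] at hx
      obtain ⟨i, hi⟩ := hx
      exact (Finset.prod_eq_zero (Finset.mem_univ i) (indicator_of_notMem hi _)).symm
  simp_rw [hI]
  rw [hprod]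
  refine Finset.prod_congr rfl fun i _ => ?_
  rw [withDensity_apply _ (hs i), ← lintegral_indicator (hs i)]
  exact (measurePreserving_eval α i).lintegral_comp (hm i)

end ExpDensity

/-! ### Gaussian densities -/

variable {N M K : ℕ}

theorem gaussianReal_eq_withExpDensity :
    gaussianReal 0 1 = withExpDensity volume
      (fun x => -Real.log (Real.sqrt (2 * Real.pi)) - x ^ 2 / 2) := by
  rw [gaussianReal_of_var_ne_zero _ one_ne_zero, gaussianPDF_def]
  congr 1 with x
  simp only [gaussianPDFReal]
  rw [sub_eq_add_neg (-Real.log _), Real.exp_add, Real.exp_neg (Real.log _),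
    Real.exp_log (by have := Real.pi_pos; positivity)]
  simp [neg_div]

theorem exists_stdGaussian_eq_withExpDensity :
    ∃ C : ℝ, stdGaussian (EuclideanSpace ℝ (Fin M)) =
      withExpDensity volume (fun x => C - (x.ofLp ⬝ᵥ x.ofLp) / 2) := by
  refine ⟨∑ _i : Fin M, -Real.log (Real.sqrt (2 * Real.pi)), ?_⟩
  -- `pi_withExpDensity` requires probability references, so Lebesgue measure is expressed through
  -- the Gaussian, the product is taken, and the relation is inverted.
  have h1 := eq_withExpDensity_neg (by fun_prop) gaussianReal_eq_withExpDensity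
  have h2 := pi_withExpDensity (fun _ : Fin M => gaussianReal 0 1)
    (h := fun _ x => -(-Real.log (Real.sqrt (2 * Real.pi)) - x ^ 2 / 2)) (fun _ => by fun_prop)
  rw [← h1, ← volume_pi] at h2
  have h3 := eq_withExpDensity_neg (by fun_prop) h2
  rw [← map_pi_eq_stdGaussian, h3, ← (PiLp.volume_preserving_toLp (Fin M)).map_eq,
    ← map_withExpDensity (by fun_prop) (by unfold dotProduct; fun_prop)]
  congr 2 with x
  simp only [dotProduct, Finset.sum_neg_distrib, neg_neg, Finset.sum_sub_distrib, Finset.sum_div]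
  simp only [pow_two]

/-- The quadratic form `(x - m)ᵀ P (x - m)`. -/
def gaussianQuad (m : EuclideanSpace ℝ (Fin M)) (P : Matrix (Fin M) (Fin M) ℝ)
    (x : EuclideanSpace ℝ (Fin M)) : ℝ :=
  (x.ofLp - m.ofLp) ⬝ᵥ (P *ᵥ (x.ofLp - m.ofLp))

@[fun_prop]
theorem measurable_gaussianQuad (m : EuclideanSpace ℝ (Fin M)) (P : Matrix (Fin M) (Fin M) ℝ) :
    Measurable (gaussianQuad m P) := by
  unfold gaussianQuad dotProduct Matrix.mulVec dotProduct
  fun_prop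

-- The Gaussian is the image of the standard one under `x ↦ m + S^(1/2) x`, which carries `xᵀx` to
-- the quadratic form of `S⁻¹` and scales Lebesgue measure by a constant. Normalizing constants are
-- never evaluated: they only shift the objective.
open scoped MatrixOrder in
theorem exists_multivariateGaussian_eq_withExpDensity (m : EuclideanSpace ℝ (Fin M))
    {S : Matrix (Fin M) (Fin M) ℝ} (hS : S.PosDef) :
    ∃ C : ℝ, multivariateGaussian m S =
      withExpDensity volume (fun x => C - gaussianQuad m S⁻¹ x / 2) := by
  obtain ⟨C, hC⟩ := exists_stdGaussian_eq_withExpDensity (M := M)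
  set A := CFC.sqrt S with hA
  have hAA : A * A = S := CFC.sqrt_mul_sqrt_self S hS.posSemidef.nonneg
  have hAsym : Aᵀ = A := by
    have := (CFC.sqrt_nonneg S).isSelfAdjoint.star_eq
    rwa [Matrix.star_eq_conjTranspose, Matrix.conjTranspose_eq_transpose_of_trivial] at this
  have hAdet : IsUnit A.det := by
    have h := hS.isUnit
    rw [Matrix.isUnit_iff_isUnit_det, ← hAA, Matrix.det_mul] at h
    exact isUnit_of_mul_isUnit_left h
  set L := Matrix.toEuclideanCLM (𝕜 := ℝ) A with hL
  set L' := Matrix.toEuclideanCLM (𝕜 := ℝ) A⁻¹ with hL'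
  have hLL' : L * L' = 1 := by rw [hL, hL', ← map_mul, Matrix.mul_nonsing_inv A hAdet, map_one]
  have hdet : LinearMap.det (L : EuclideanSpace ℝ (Fin M) →ₗ[ℝ] EuclideanSpace ℝ (Fin M)) ≠ 0 := by
    intro h0
    have h1 : (L : EuclideanSpace ℝ (Fin M) →ₗ[ℝ] EuclideanSpace ℝ (Fin M)) *
        (L' : EuclideanSpace ℝ (Fin M) →ₗ[ℝ] EuclideanSpace ℝ (Fin M)) = 1 := by
      ext1 x
      exact congrArg (fun T => T x) hLL'
    have h2 := congrArg LinearMap.det h1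
    rw [map_mul, h0, zero_mul, map_one] at h2
    exact zero_ne_one h2
  have hq (x : EuclideanSpace ℝ (Fin M)) : gaussianQuad m S⁻¹ (m + L x) = x.ofLp ⬝ᵥ x.ofLp := by
    rw [gaussianQuad]
    simp only [WithLp.ofLp_add, add_sub_cancel_left, hL, Matrix.ofLp_toEuclideanCLM]
    have hv : A *ᵥ x.ofLp = x.ofLp ᵥ* A := by rw [← Matrix.vecMul_transpose, hAsym]
    rw [← hAA, Matrix.mul_inv_rev, Matrix.mulVec_mulVec, mul_assoc, Matrix.nonsing_inv_mul A hAdet,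
      mul_one, hv, ← Matrix.dotProduct_mulVec, Matrix.mulVec_mulVec, Matrix.mul_nonsing_inv A hAdet,
      Matrix.one_mulVec]
  set D := |(LinearMap.det (L : EuclideanSpace ℝ (Fin M) →ₗ[ℝ] EuclideanSpace ℝ (Fin M)))⁻¹| with hD
  have hDpos : 0 < D := abs_pos.mpr (inv_ne_zero hdet)
  have hvol : (volume : Measure (EuclideanSpace ℝ (Fin M))).map (fun x => m + L x) =
      withExpDensity volume (fun _ => Real.log D) := by
    have h1 : (fun x => m + L x) = (fun x => m + x) ∘ L := rfl
    have h2 := Measure.map_linearMap_addHaar_eq_smul_addHaar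
      (volume : Measure (EuclideanSpace ℝ (Fin M))) hdet
    rw [h1, ← Measure.map_map (by fun_prop) (by fun_prop)]
    change Measure.map _ (Measure.map (L : EuclideanSpace ℝ (Fin M) →ₗ[ℝ] EuclideanSpace ℝ (Fin M)) _) = _
    rw [h2, Measure.map_smul, map_add_left_eq_self, withExpDensity, Real.exp_log hDpos,
      withDensity_const]
  refine ⟨Real.log D + C, ?_⟩
  rw [multivariateGaussian, hC]
  have h3 := map_withExpDensity (α := (volume : Measure (EuclideanSpace ℝ (Fin M))))
    (e := fun x => m + L x) (by fun_prop) (h := fun x => C - gaussianQuad m S⁻¹ x / 2) (by fun_prop)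
  simp only [hq] at h3
  rw [h3, hvol, withExpDensity_withExpDensity measurable_const (by fun_prop)]
  congr 1 with x
  ring_nf

theorem exists_gaussianLaw_eq_withExpDensity (m m' : Fin K → EuclideanSpace ℝ (Fin M))
    {S S' : Fin K → Matrix (Fin M) (Fin M) ℝ} (hS : ∀ k, (S k).PosDef) (hS' : ∀ k, (S' k).PosDef) :
    ∃ C : ℝ, gaussianLaw m S = withExpDensity (gaussianLaw m' S') (fun B =>
      C + ∑ k, (gaussianQuad (m' k) (S' k)⁻¹ (B k) / 2 - gaussianQuad (m k) (S k)⁻¹ (B k) / 2)) := by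
  choose C hC using fun k => exists_multivariateGaussian_eq_withExpDensity (m k) (hS k)
  choose C' hC' using fun k => exists_multivariateGaussian_eq_withExpDensity (m' k) (hS' k)
  refine ⟨∑ k, (-C' k + C k), ?_⟩
  have h (k : Fin K) : multivariateGaussian (m k) (S k) =
      withExpDensity (multivariateGaussian (m' k) (S' k)) (fun x =>
        -(C' k - gaussianQuad (m' k) (S' k)⁻¹ x / 2) + (C k - gaussianQuad (m k) (S k)⁻¹ x / 2)) := by
    rw [← withExpDensity_withExpDensity (by fun_prop) (by fun_prop),
      ← eq_withExpDensity_neg (by fun_prop) (hC' k), ← hC k]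
  rw [gaussianLaw]
  simp_rw [h]
  rw [pi_withExpDensity (fun k => multivariateGaussian (m' k) (S' k)) (h := fun k x =>
    -(C' k - gaussianQuad (m' k) (S' k)⁻¹ x / 2) + (C k - gaussianQuad (m k) (S k)⁻¹ x / 2))
    (fun k => by fun_prop), gaussianLaw]
  congr 1 with B
  rw [← Finset.sum_add_distrib]
  congr 3 with k
  ring

/-- Gaussianity of the joint law gives access to Fernique's theorem for `‖B‖²`. -/
instance (m : Fin K → EuclideanSpace ℝ (Fin M)) (S : Fin K → Matrix (Fin M) (Fin M) ℝ) :
    IsGaussian (gaussianLaw m S) := by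
  have h1 (k : Fin K) : HasGaussianLaw (fun B : Weights M K => B k) (gaussianLaw m S) := by
    constructor
    have := (measurePreserving_eval (fun k => multivariateGaussian (m k) (S k)) k).map_eq
    change IsGaussian ((Measure.pi fun k => multivariateGaussian (m k) (S k)).map (Function.eval k))
    rw [this]
    infer_instance
  have h2 : iIndepFun (fun k (B : Weights M K) => B k) (gaussianLaw m S) :=
    iIndepFun_pi (X := fun _ x => x) fun k => aemeasurable_id
  have := (iIndepFun.hasGaussianLaw h1 h2).isGaussian_map
  simpa using this

theorem expIntegrable_norm_sq_gaussianLaw (m : Fin K → EuclideanSpace ℝ (Fin M))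
    (S : Fin K → Matrix (Fin M) (Fin M) ℝ) :
    ExpIntegrable (fun B : Weights M K => ‖B‖ ^ 2) (gaussianLaw m S) :=
  IsGaussian.exists_integrable_exp_sq _

theorem weightsMean_gaussianLaw (m : Fin K → EuclideanSpace ℝ (Fin M))
    (S : Fin K → Matrix (Fin M) (Fin M) ℝ) : weightsMean (gaussianLaw m S) = m := by
  funext k
  have := (measurePreserving_eval (fun k => multivariateGaussian (m k) (S k)) k).map_eq
  rw [weightsMean, gaussianLaw, ← integral_id_multivariateGaussian (μ := m k) (S := S k), ← this,
    integral_map (measurable_pi_apply k).aemeasurable (by fun_prop)]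

theorem weightsCov_gaussianLaw (m : Fin K → EuclideanSpace ℝ (Fin M))
    {S : Fin K → Matrix (Fin M) (Fin M) ℝ} (hS : ∀ k, (S k).PosDef) :
    weightsCov (gaussianLaw m S) = S := by
  funext k
  ext a b
  have := (measurePreserving_eval (fun k => multivariateGaussian (m k) (S k)) k).map_eq
  have h := covariance_map (μ := Measure.pi fun k => multivariateGaussian (m k) (S k))
    (X := fun x : EuclideanSpace ℝ (Fin M) => x a) (Y := fun x : EuclideanSpace ℝ (Fin M) => x b)
    (Z := Function.eval k) (by fun_prop) (by fun_prop) (measurable_pi_apply k).aemeasurable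
  rw [this, covariance_eval_multivariateGaussian (hS k).posSemidef a b] at h
  exact h.symm

/-! ### Pólya–Gamma product laws -/

theorem expIntegrable_pi {ι : Type*} [Fintype ι] {E : ι → Type*} [∀ i, MeasurableSpace (E i)]
    {α : ∀ i, Measure (E i)} [∀ i, IsProbabilityMeasure (α i)] {n : ∀ i, E i → ℝ}
    (hn : ∀ i, Measurable (n i)) (hn0 : ∀ i x, 0 ≤ n i x) (h : ∀ i, ExpIntegrable (n i) (α i)) :
    ExpIntegrable (fun x => ∑ i, n i (x i)) (Measure.pi α) := by
  choose ε hε hint using h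
  -- A positive rate below all the `ε i`; the filter also covers an empty index type.
  obtain ⟨δ, hδ⟩ := (eventually_all.mpr fun i => Ioo_mem_nhdsGT (hε i) :
    ∀ᶠ δ in 𝓝[>] (0 : ℝ), ∀ i, δ ∈ Ioo 0 (ε i)).and self_mem_nhdsWithin |>.exists
  refine ⟨δ, hδ.2, ?_⟩
  have h := Integrable.fintype_prod_dep (μ := α) (f := fun i x => Real.exp (δ * n i x)) fun i => by
    have := hn i
    refine (hint i).mono' (by fun_prop) (Eventually.of_forall fun x => ?_)
    rw [Real.norm_of_nonneg (Real.exp_pos _).le, Real.exp_le_exp]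
    exact mul_le_mul_of_nonneg_right (hδ.1 i).2.le (hn0 i x)
  refine h.congr (Eventually.of_forall fun x => ?_)
  simp only [Finset.mul_sum, Real.exp_sum]

theorem polyaGamma_eq_withExpDensity (c : ℝ) :
    polyaGamma 1 c = withExpDensity (polyaGamma 1 0)
      (fun w => Real.log (Real.cosh (c / 2)) - c ^ 2 / 2 * w) := by
  rw [polyaGamma_eq_withDensity, withExpDensity]
  congr 1 with w
  rw [sub_eq_add_neg, Real.exp_add, Real.exp_log (Real.cosh_pos _), neg_mul]

theorem polyaGammaLaw_eq_withExpDensity (c : Fin N → Fin K → ℝ) :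
    polyaGammaLaw (fun _ _ => 1) c = withExpDensity (polyaGammaLaw (fun _ _ => 1) 0)
      (fun ω => ∑ i, ∑ k, (Real.log (Real.cosh (c i k / 2)) - c i k ^ 2 / 2 * ω i k)) := by
  have h1 (i : Fin N) : Measure.pi (fun k => polyaGamma 1 (c i k)) =
      withExpDensity (Measure.pi fun _ => polyaGamma 1 0)
        (fun v => ∑ k, (Real.log (Real.cosh (c i k / 2)) - c i k ^ 2 / 2 * v k)) := by
    rw [← pi_withExpDensity (fun _ : Fin K => polyaGamma 1 0)
      (h := fun k w => Real.log (Real.cosh (c i k / 2)) - c i k ^ 2 / 2 * w) (fun k => by fun_prop)]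
    congr 1 with k : 1
    exact polyaGamma_eq_withExpDensity (c i k)
  rw [polyaGammaLaw]
  simp_rw [h1]
  exact pi_withExpDensity (fun _ : Fin N => Measure.pi fun _ : Fin K => polyaGamma 1 0)
    (h := fun i v => ∑ k, (Real.log (Real.cosh (c i k / 2)) - c i k ^ 2 / 2 * v k))
    (fun i => by fun_prop)

/-- `∑ |ω_ik|`. -/
def auxNorm (ω : Aux N K) : ℝ := ∑ i, ∑ k, |ω i k|

@[fun_prop]
theorem measurable_auxNorm : Measurable (auxNorm (N := N) (K := K)) := by
  unfold auxNorm; fun_prop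

theorem auxNorm_nonneg (ω : Aux N K) : 0 ≤ auxNorm ω :=
  Finset.sum_nonneg fun _ _ => Finset.sum_nonneg fun _ _ => abs_nonneg _

theorem abs_le_auxNorm (ω : Aux N K) (i : Fin N) (k : Fin K) : |ω i k| ≤ auxNorm ω :=
  (Finset.single_le_sum (f := fun k => |ω i k|) (fun _ _ => abs_nonneg _) (Finset.mem_univ k)).trans
    (Finset.single_le_sum (f := fun i => ∑ k, |ω i k|)
      (fun _ _ => Finset.sum_nonneg fun _ _ => abs_nonneg _) (Finset.mem_univ i))

theorem expIntegrable_auxNorm (c : Fin N → Fin K → ℝ) :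
    ExpIntegrable auxNorm (polyaGammaLaw (fun _ _ => 1) c) := by
  have h1 (i : Fin N) : ExpIntegrable (fun v : Fin K → ℝ => ∑ k, |v k|)
      (Measure.pi fun k => polyaGamma 1 (c i k)) :=
    expIntegrable_pi (α := fun k => polyaGamma 1 (c i k)) (n := fun _ w => |w|)
      (fun _ => by fun_prop) (fun _ _ => abs_nonneg _)
      fun k => exists_integrable_exp_abs_polyaGamma (c i k)
  exact expIntegrable_pi (α := fun i => Measure.pi fun k => polyaGamma 1 (c i k))
    (n := fun _ v => ∑ k, |v k|) (fun _ => by fun_prop)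
    (fun _ _ => Finset.sum_nonneg fun _ _ => abs_nonneg _) h1

theorem measurePreserving_eval_polyaGammaLaw (c : Fin N → Fin K → ℝ) (i : Fin N) (k : Fin K) :
    MeasurePreserving (fun ω : Aux N K => ω i k) (polyaGammaLaw (fun _ _ => 1) c)
      (polyaGamma 1 (c i k)) :=
  (measurePreserving_eval (fun k => polyaGamma 1 (c i k)) k).comp
    (measurePreserving_eval (fun i => Measure.pi fun k => polyaGamma 1 (c i k)) i)

theorem ae_nonneg_polyaGammaLaw (c : Fin N → Fin K → ℝ) (i : Fin N) (k : Fin K) :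
    ∀ᵐ ω ∂(polyaGammaLaw (fun _ _ => 1) c), 0 ≤ ω i k :=
  (measurePreserving_eval_polyaGammaLaw c i k).quasiMeasurePreserving.ae (ae_nonneg_polyaGamma (c i k))

theorem auxMean_polyaGammaLaw (c : Fin N → Fin K → ℝ) :
    auxMean (polyaGammaLaw (fun _ _ => 1) c) = fun i k => polyaGammaMean 1 (c i k) := by
  funext i k
  have h := measurePreserving_eval_polyaGammaLaw c i k
  rw [auxMean, ← integral_id_polyaGamma, ← h.map_eq, integral_map h.measurable.aemeasurable
    (by fun_prop)]

/-! ### The augmented model as an exponential density -/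

/-- `∑ (κ_ik η_ik - log 2)`, so that `log p(Y | B) = linPart X y B - ∑ log cosh (η_ik / 2)`. -/
def linPart (X : Matrix (Fin N) (Fin M) ℝ) (y : Fin N → Fin K → Bool) (B : Weights M K) : ℝ :=
  ∑ i, ∑ k, (kappa y k i * linPred X B i k - Real.log 2)

/-- `(κ_ik η_ik - log 2) - ω_ik η_ik² / 2`, summed over `i` and `k`. -/
def logRatio (X : Matrix (Fin N) (Fin M) ℝ) (y : Fin N → Fin K → Bool) (p : Weights M K × Aux N K) :
    ℝ :=
  linPart X y p.1 - ∑ j : Fin N × Fin K, (linPred X p.1 j.1 j.2 ^ 2 / 2) * p.2 j.1 j.2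

/-- Dividing through by `exp (η/2)` turns the two Bernoulli probabilities into `exp (±η/2) / (2 cosh
(η/2))`. -/
theorem likelihood_eq_exp (X : Matrix (Fin N) (Fin M) ℝ) (y : Fin N → Fin K → Bool)
    (B : Weights M K) : likelihood X y B = Real.exp (linPart X y B -
      ∑ i, ∑ k, Real.log (Real.cosh (linPred X B i k / 2))) := by
  rw [linPart, ← Finset.sum_sub_distrib, Real.exp_sum, likelihood]
  refine Finset.prod_congr rfl fun i _ => ?_
  rw [← Finset.sum_sub_distrib, Real.exp_sum]
  refine Finset.prod_congr rfl fun k _ => ?_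
  set e := linPred X B i k
  have hE : Real.exp e = Real.exp (e / 2) ^ 2 := by
    rw [← Real.exp_nat_mul]; congr 1; push_cast; ring
  have hp := Real.exp_pos (e / 2)
  rw [Real.exp_sub, Real.exp_sub, Real.exp_log two_pos, Real.exp_log (Real.cosh_pos _), Real.cosh_eq,
    Real.exp_neg, hE, kappa]
  cases y i k
  · simp only [Bool.false_eq_true, if_false]
    rw [show (0 - 1 / 2 : ℝ) * e = -(e / 2) by ring, Real.exp_neg]
    field_simp
    ring
  · simp only [if_true]
    rw [show (1 - 1 / 2 : ℝ) * e = e / 2 by ring]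
    field_simp
    ring

attribute [fun_prop] measurable_linPred

@[fun_prop]
theorem measurable_linPart (X : Matrix (Fin N) (Fin M) ℝ) (y : Fin N → Fin K → Bool) :
    Measurable (linPart X y) := by
  unfold linPart; fun_prop

theorem compProd_auxKernel (X : Matrix (Fin N) (Fin M) ℝ) (α : Measure (Weights M K)) [SFinite α] :
    α ⊗ₘ auxKernel X = withExpDensity (α.prod (polyaGammaLaw (fun _ _ => 1) 0)) (fun p =>
      ∑ i, ∑ k, (Real.log (Real.cosh (linPred X p.1 i k / 2)) - linPred X p.1 i k ^ 2 / 2 * p.2 i k)) := by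
  have hm (i : Fin N) (k : Fin K) : Measurable fun p : Weights M K × Aux N K => linPred X p.1 i k :=
    (measurable_linPred X i k).comp measurable_fst
  have hc : Measurable fun p : Weights M K × Aux N K =>
      ∑ i, ∑ k, (Real.log (Real.cosh (linPred X p.1 i k / 2)) - linPred X p.1 i k ^ 2 / 2 * p.2 i k) := by
    refine Finset.measurable_fun_sum _ fun i _ => Finset.measurable_fun_sum _ fun k _ => ?_
    have := hm i k
    exact ((Real.continuous_cosh.measurable.comp (this.div_const 2)).log).sub (by fun_prop)
  refine Measure.ext_of_lintegral _ fun φ hφ => ?_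
  rw [Measure.lintegral_compProd hφ, lintegral_withDensity_eq_lintegral_mul _ (by fun_prop) hφ,
    lintegral_prod _ (by fun_prop)]
  refine lintegral_congr fun B => ?_
  change ∫⁻ ω, φ (B, ω) ∂(polyaGammaLaw (fun _ _ => 1) (linPred X B)) = _
  rw [polyaGammaLaw_eq_withExpDensity, lintegral_withDensity_eq_lintegral_mul _ (by fun_prop)
    (by fun_prop)]
  rfl

/-- The `cosh` normalizing the tilted law of `Ω` given `B` cancels the one in the likelihood, so `B`
and `Ω` interact only through `ω η²`. -/
theorem jointMeasure_eq_withExpDensity (X : Matrix (Fin N) (Fin M) ℝ) (y : Fin N → Fin K → Bool)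
    (μ₀ : EuclideanSpace ℝ (Fin M)) (S₀ : Matrix (Fin M) (Fin M) ℝ) :
    jointMeasure X y μ₀ S₀ = withExpDensity
      ((gaussianLaw (fun _ => μ₀) (fun _ => S₀)).prod (polyaGammaLaw (fun _ _ => 1) 0))
      (logRatio X y) := by
  have hm (i : Fin N) (k : Fin K) : Measurable fun p : Weights M K × Aux N K => linPred X p.1 i k :=
    (measurable_linPred X i k).comp measurable_fst
  have hc (i : Fin N) (k : Fin K) : Measurable fun p : Weights M K × Aux N K =>
      Real.log (Real.cosh (linPred X p.1 i k / 2)) :=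
    (Real.continuous_cosh.measurable.comp ((hm i k).div_const 2)).log
  have hl : Measurable fun p : Weights M K × Aux N K => linPart X y p.1 :=
    (measurable_linPart X y).comp measurable_fst
  rw [jointMeasure, compProd_auxKernel]
  simp_rw [likelihood_eq_exp]
  change withExpDensity (withExpDensity _ _) _ = _
  rw [withExpDensity_withExpDensity (by fun_prop) (by fun_prop)]
  congr 1 with p
  rw [logRatio, Fintype.sum_prod_type]
  simp only [Finset.sum_sub_distrib]
  ring

/-! ### Growth bounds -/

theorem abs_linPred_le (X : Matrix (Fin N) (Fin M) ℝ) (B : Weights M K) (i : Fin N) (k : Fin K) :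
    |linPred X B i k| ≤ (∑ i, ∑ j, |X i j|) * ‖B‖ := by
  have h0 : ∀ i, 0 ≤ ∑ j, |X i j| := fun i => Finset.sum_nonneg fun _ _ => abs_nonneg _
  calc |linPred X B i k| ≤ ∑ j, |X i j * B k j| := by
        rw [linPred, dotProduct]; exact Finset.abs_sum_le_sum_abs _ _
    _ ≤ ∑ j, |X i j| * ‖B‖ := by
        refine Finset.sum_le_sum fun j _ => ?_
        rw [abs_mul]
        gcongr
        exact (PiLp.norm_apply_le (B k) j).trans (norm_le_pi_norm B k)
    _ = (∑ j, |X i j|) * ‖B‖ := by rw [Finset.sum_mul]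
    _ ≤ _ := by
        gcongr
        exact Finset.single_le_sum (f := fun i => ∑ j, |X i j|) (fun i _ => h0 i) (Finset.mem_univ i)

theorem linPred_sq_le (X : Matrix (Fin N) (Fin M) ℝ) (B : Weights M K) (i : Fin N) (k : Fin K) :
    linPred X B i k ^ 2 / 2 ≤ (∑ i, ∑ j, |X i j|) ^ 2 * ‖B‖ ^ 2 := by
  have h := pow_le_pow_left₀ (abs_nonneg _) (abs_linPred_le X B i k) 2
  rw [sq_abs, mul_pow] at h
  have := sq_nonneg (linPred X B i k)
  linarith

theorem abs_linPart_le (X : Matrix (Fin N) (Fin M) ℝ) (y : Fin N → Fin K → Bool) {δ : ℝ}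
    (hδ : 0 < δ) : ∃ C, ∀ B : Weights M K, |linPart X y B| ≤ C + δ * ‖B‖ ^ 2 := by
  set a := ∑ i, ∑ j, |X i j| with ha
  have hbound (B : Weights M K) : |linPart X y B| ≤ N * (K * (a * ‖B‖ + Real.log 2)) := by
    calc |linPart X y B| ≤ ∑ _i : Fin N, ∑ _k : Fin K, (a * ‖B‖ + Real.log 2) := by
          refine (Finset.abs_sum_le_sum_abs _ _).trans (Finset.sum_le_sum fun i _ =>
            (Finset.abs_sum_le_sum_abs _ _).trans (Finset.sum_le_sum fun k _ => ?_))
          refine (abs_sub _ _).trans (add_le_add ?_ (abs_of_pos (Real.log_pos one_lt_two)).le)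
          rw [abs_mul]
          have hk : |kappa y k i| ≤ 1 := by
            rw [kappa]; split_ifs <;> norm_num [abs_le]
          calc _ ≤ 1 * |linPred X B i k| := by gcongr
            _ ≤ _ := by rw [one_mul]; exact abs_linPred_le X B i k
      _ = _ := by simp only [Finset.sum_const, Finset.card_univ, Fintype.card_fin, nsmul_eq_mul]
  -- The linear growth `b * ‖B‖` is absorbed by completing a square, at the price `b² / (4δ)`.
  refine ⟨N * (K * Real.log 2) + (N * (K * a)) ^ 2 / (4 * δ), fun B => (hbound B).trans ?_⟩
  set b := (N : ℝ) * (K * a)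
  have h1 : b * ‖B‖ ≤ b ^ 2 / (4 * δ) + δ * ‖B‖ ^ 2 := by
    have h2 : b ^ 2 / (4 * δ) + δ * ‖B‖ ^ 2 - b * ‖B‖ = (b - 2 * δ * ‖B‖) ^ 2 / (4 * δ) := by
      field_simp; ring
    have h3 : 0 ≤ (b - 2 * δ * ‖B‖) ^ 2 / (4 * δ) := by positivity
    linarith
  calc (N : ℝ) * (K * (a * ‖B‖ + Real.log 2)) = b * ‖B‖ + N * (K * Real.log 2) := by
        simp only [b]; ring
    _ ≤ _ := by linarith

theorem exists_abs_gaussianQuad_le (m : EuclideanSpace ℝ (Fin M)) (P : Matrix (Fin M) (Fin M) ℝ) :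
    ∃ C, ∀ x, |gaussianQuad m P x| ≤ C * (1 + ‖x‖ ^ 2) := by
  set T := Matrix.toEuclideanCLM (𝕜 := ℝ) P
  refine ⟨‖T‖ * (2 * (1 + ‖m‖ ^ 2)), fun x => ?_⟩
  have h1 : gaussianQuad m P x = inner ℝ (x - m) (T (x - m)) := by
    rw [Matrix.inner_toEuclideanCLM]; rfl
  have h2 : ‖x - m‖ ^ 2 ≤ 2 * (1 + ‖m‖ ^ 2) * (1 + ‖x‖ ^ 2) := by
    have h3 := pow_le_pow_left₀ (norm_nonneg _) (norm_sub_le x m) 2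
    nlinarith [sq_nonneg (‖x‖ - ‖m‖), mul_nonneg (sq_nonneg ‖x‖) (sq_nonneg ‖m‖)]
  calc |gaussianQuad m P x| ≤ ‖x - m‖ * (‖T‖ * ‖x - m‖) := by
        rw [h1]
        exact (abs_real_inner_le_norm _ _).trans
          (mul_le_mul_of_nonneg_left (T.le_opNorm _) (norm_nonneg _))
    _ = ‖T‖ * ‖x - m‖ ^ 2 := by ring
    _ ≤ ‖T‖ * (2 * (1 + ‖m‖ ^ 2) * (1 + ‖x‖ ^ 2)) := by gcongr
    _ = _ := by ring

theorem exists_abs_gaussianLaw_exponent_le (m m' : Fin K → EuclideanSpace ℝ (Fin M))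
    (P P' : Fin K → Matrix (Fin M) (Fin M) ℝ) (C : ℝ) :
    ∃ D, ∀ B : Weights M K, |C + ∑ k, (gaussianQuad (m' k) (P' k) (B k) / 2 -
      gaussianQuad (m k) (P k) (B k) / 2)| ≤ D * (1 + ‖B‖ ^ 2) := by
  choose a ha using fun k => exists_abs_gaussianQuad_le (m k) (P k)
  choose a' ha' using fun k => exists_abs_gaussianQuad_le (m' k) (P' k)
  refine ⟨|C| + ∑ k, (|a' k| + |a k|), fun B => ?_⟩
  have h1 (B : Weights M K) : (1 : ℝ) ≤ 1 + ‖B‖ ^ 2 := by nlinarith [sq_nonneg ‖B‖]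
  have hn (k : Fin K) : 1 + ‖B k‖ ^ 2 ≤ 1 + ‖B‖ ^ 2 := by
    gcongr; exact norm_le_pi_norm B k
  rw [add_mul, Finset.sum_mul]
  refine (abs_add_le _ _).trans (add_le_add (le_mul_of_one_le_right (abs_nonneg _) (h1 B)) ?_)
  refine (Finset.abs_sum_le_sum_abs _ _).trans (Finset.sum_le_sum fun k _ => ?_)
  have hq (a q : ℝ) (h : |q| ≤ a * (1 + ‖B k‖ ^ 2)) : |q / 2| ≤ |a| * (1 + ‖B‖ ^ 2) := by
    have h2 : a * (1 + ‖B k‖ ^ 2) ≤ |a| * (1 + ‖B‖ ^ 2) := by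
      calc a * (1 + ‖B k‖ ^ 2) ≤ |a| * (1 + ‖B k‖ ^ 2) := by gcongr; exact le_abs_self a
        _ ≤ _ := by gcongr |a| * ?_; exact hn k
    rw [abs_div, abs_two]
    linarith [abs_nonneg q]
  refine (abs_sub _ _).trans ?_
  rw [add_mul]
  exact add_le_add (hq _ _ (ha' k _)) (hq _ _ (ha k _))

/-! ### The objective on product measures -/

section Objective

variable (X : Matrix (Fin N) (Fin M) ℝ) (y : Fin N → Fin K → Bool)
  (μ₀ : EuclideanSpace ℝ (Fin M)) (S₀ : Matrix (Fin M) (Fin M) ℝ)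

/-- The prior law of `B`. -/
abbrev priorLaw : Measure (Weights M K) := gaussianLaw (fun _ => μ₀) (fun _ => S₀)

/-- The law of `Ω` with independent `PG(1, 0)` entries. -/
abbrev auxBase : Measure (Aux N K) := polyaGammaLaw (fun _ _ => 1) 0

theorem elbo_prod (μ : Measure (Weights M K)) (ν : Measure (Aux N K)) [IsProbabilityMeasure μ]
    [IsProbabilityMeasure ν] :
    (elbo X y μ₀ S₀ (μ.prod ν) ≠ ⊥ ↔ klDiv μ (priorLaw μ₀ S₀) ≠ ⊤ ∧ klDiv ν auxBase ≠ ⊤) ∧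
    (klDiv μ (priorLaw μ₀ S₀) ≠ ⊤ → klDiv ν auxBase ≠ ⊤ → elbo X y μ₀ S₀ (μ.prod ν) =
      ((-((klDiv μ (priorLaw μ₀ S₀)).toReal + (klDiv ν auxBase).toReal - ∫ B, linPart X y B ∂μ +
        ∑ j : Fin N × Fin K, (∫ B, linPred X B j.1 j.2 ^ 2 / 2 ∂μ) * ∫ ω, ω j.1 j.2 ∂ν) : ℝ) :
        EReal)) := by
  have h := klDiv_prod_withExpDensity (α := priorLaw (K := K) μ₀ S₀) (β := auxBase (N := N) (K := K))
    (u := linPart X y) (n := fun B => ‖B‖ ^ 2) (n' := auxNorm)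
    (f := fun (j : Fin N × Fin K) B => linPred X B j.1 j.2 ^ 2 / 2)
    (g := fun (j : Fin N × Fin K) ω => ω j.1 j.2) (by fun_prop) (by fun_prop)
    (fun B => by positivity) (by fun_prop) auxNorm_nonneg (fun j => by fun_prop)
    (fun j => by fun_prop) (fun δ hδ => abs_linPart_le X y hδ) (fun j B => by positivity)
    (fun j B => linPred_sq_le X B j.1 j.2) (fun j => ae_nonneg_polyaGammaLaw 0 j.1 j.2)
    (fun j ω => abs_le_auxNorm ω j.1 j.2) (expIntegrable_norm_sq_gaussianLaw _ _)
    (expIntegrable_auxNorm 0) (ψ := logRatio X y) rfl μ ν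
  rw [← jointMeasure_eq_withExpDensity] at h
  -- Both sides encode the same condition: absolute continuity and an integrable log-ratio.
  have hdef : elbo X y μ₀ S₀ (μ.prod ν) ≠ ⊥ ↔ klDiv (μ.prod ν) (jointMeasure X y μ₀ S₀) ≠ ⊤ := by
    rw [klDiv_ne_top_iff, elbo]
    split_ifs with hc
    · simp [hc]
    · simp [hc]
  refine ⟨hdef.trans h.1, fun h1 h2 => ?_⟩
  have hk := klDiv_ne_top_iff.mp (h.1.mpr ⟨h1, h2⟩)
  rw [elbo, if_pos hk, integral_neg, h.2 h1 h2]

end Objective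

/-- A functional that is a constant minus the relative entropy with respect to a probability measure
is maximized exactly at that measure. -/
theorem maximizer_iff_of_eq_sub_klDiv {𝒳 : Type*} [MeasurableSpace 𝒳] {F : Measure 𝒳 → EReal}
    {τ : Measure 𝒳} [IsProbabilityMeasure τ] {C : ℝ}
    (hbot : ∀ ρ : Measure 𝒳, IsProbabilityMeasure ρ → (F ρ ≠ ⊥ ↔ klDiv ρ τ ≠ ⊤))
    (hval : ∀ ρ : Measure 𝒳, IsProbabilityMeasure ρ → klDiv ρ τ ≠ ⊤ →
      F ρ = ((C - (klDiv ρ τ).toReal : ℝ) : EReal)) (q : Measure 𝒳) :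
    (IsProbabilityMeasure q ∧ ∀ ρ : Measure 𝒳, IsProbabilityMeasure ρ → F ρ ≤ F q) ↔ q = τ := by
  have hτ : F τ = (C : EReal) := by
    rw [hval τ inferInstance (by simp [klDiv_self]), klDiv_self]
    simp
  constructor
  · rintro ⟨hq, h⟩
    have h1 := h τ inferInstance
    have hk : klDiv q τ ≠ ⊤ := by
      rw [← hbot q hq]
      intro h0
      rw [hτ, h0] at h1
      exact EReal.coe_ne_bot C (le_bot_iff.mp h1)
    rw [hτ, hval q hq hk, EReal.coe_le_coe_iff] at h1
    have h0 : (klDiv q τ).toReal = 0 :=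
      le_antisymm (by linarith) ENNReal.toReal_nonneg
    rw [ENNReal.toReal_eq_zero_iff] at h0
    exact klDiv_eq_zero_iff.mp (h0.resolve_right hk)
  · intro hq
    rw [hq]
    refine ⟨inferInstance, fun ρ hρ => ?_⟩
    by_cases h : F ρ = ⊥
    · rw [h]; exact bot_le
    · rw [hτ, hval ρ hρ ((hbot ρ hρ).mp h), EReal.coe_le_coe_iff]
      linarith [ENNReal.toReal_nonneg (a := klDiv ρ τ)]

/-! ### Second moments -/

theorem memLp_weights {q : Measure (Weights M K)} [IsProbabilityMeasure q]
    (h : Integrable (fun B => ‖B‖ ^ 2) q) (k : Fin K) : MemLp (fun B : Weights M K => B k) 2 q := by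
  rw [memLp_two_iff_integrable_sq_norm (measurable_pi_apply k).aestronglyMeasurable]
  refine h.mono' (Measurable.aestronglyMeasurable (by fun_prop)) (Eventually.of_forall fun B => ?_)
  rw [Real.norm_of_nonneg (by positivity)]
  gcongr
  exact norm_le_pi_norm B k

/-- Variance plus squared mean of the linear predictor is its second moment. -/
theorem updateC_sq (X : Matrix (Fin N) (Fin M) ℝ) {q : Measure (Weights M K)}
    [IsProbabilityMeasure q] (h : ∀ k, MemLp (fun B : Weights M K => B k) 2 q) (i : Fin N)
    (k : Fin K) :
    updateC X (weightsMean q) (weightsCov q) i k ^ 2 = ∫ B, linPred X B i k ^ 2 ∂q := by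
  have hc (j : Fin M) : MemLp (fun B : Weights M K => B k j) 2 q :=
    (h k).mono (Measurable.aestronglyMeasurable (by fun_prop)) (Eventually.of_forall fun B => PiLp.norm_apply_le (B k) j)
  have hXc (j : Fin M) : MemLp (fun B : Weights M K => X i j * B k j) 2 q := (hc j).const_mul _
  have hlin : MemLp (fun B : Weights M K => linPred X B i k) 2 q :=
    memLp_finsetSum Finset.univ fun j _ => hXc j
  have hmean : ∫ B, linPred X B i k ∂q = X i ⬝ᵥ (weightsMean q k).ofLp := by
    simp only [linPred, dotProduct]
    rw [integral_finsetSum _ fun j _ => (hXc j).integrable one_le_two]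
    refine Finset.sum_congr rfl fun j _ => ?_
    rw [integral_const_mul]
    congr 1
    exact (EuclideanSpace.proj (𝕜 := ℝ) j).integral_comp_comm ((h k).integrable one_le_two)
  have hvar : Var[fun B => linPred X B i k; q] = X i ⬝ᵥ (weightsCov q k *ᵥ X i) := by
    rw [← covariance_self (by fun_prop)]
    simp only [linPred, dotProduct]
    rw [covariance_fun_sum_fun_sum (fun j => hXc j) (fun j => hXc j)]
    refine Finset.sum_congr rfl fun a _ => ?_
    rw [Matrix.mulVec, dotProduct, Finset.mul_sum]
    refine Finset.sum_congr rfl fun b _ => ?_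
    rw [covariance_const_mul_left, covariance_const_mul_right, weightsCov, Matrix.of_apply]
    ring
  have hv := variance_eq_sub hlin
  have h0 := variance_nonneg (fun B => linPred X B i k) q
  rw [updateC, ← hvar, ← hmean, Real.sq_sqrt (by positivity), hv]
  simp

/-! ### The optimal factors -/

theorem integrable_norm_sq_of_klDiv {μ₀ : EuclideanSpace ℝ (Fin M)}
    {S₀ : Matrix (Fin M) (Fin M) ℝ} {q : Measure (Weights M K)} [IsProbabilityMeasure q]
    (h : klDiv q (priorLaw μ₀ S₀) ≠ ⊤) : Integrable (fun B => ‖B‖ ^ 2) q :=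
  integrable_of_klDiv_ne_top (by fun_prop) (fun B => by positivity)
    (expIntegrable_norm_sq_gaussianLaw _ _) h

theorem integrable_aux_of_klDiv {q : Measure (Aux N K)} [IsProbabilityMeasure q]
    (h : klDiv q auxBase ≠ ⊤) (i : Fin N) (k : Fin K) : Integrable (fun ω => ω i k) q :=
  (integrable_of_klDiv_ne_top measurable_auxNorm auxNorm_nonneg (expIntegrable_auxNorm 0) h).mono'
    (Measurable.aestronglyMeasurable (by fun_prop))
    (Eventually.of_forall fun ω => abs_le_auxNorm ω i k)

theorem abs_polyaGammaLaw_exponent_le (c : Fin N → Fin K → ℝ) :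
    ∃ D, ∀ ω : Aux N K, |∑ i, ∑ k, (Real.log (Real.cosh (c i k / 2)) - c i k ^ 2 / 2 * ω i k)| ≤
      D * (1 + auxNorm ω) := by
  refine ⟨∑ i, ∑ k, (|Real.log (Real.cosh (c i k / 2))| + c i k ^ 2 / 2), fun ω => ?_⟩
  have h0 := auxNorm_nonneg ω
  simp only [Finset.sum_mul]
  refine (Finset.abs_sum_le_sum_abs _ _).trans (Finset.sum_le_sum fun i _ =>
    (Finset.abs_sum_le_sum_abs _ _).trans (Finset.sum_le_sum fun k _ => (abs_sub _ _).trans ?_))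
  rw [add_mul]
  refine add_le_add (le_mul_of_one_le_right (abs_nonneg _) (by linarith)) ?_
  rw [abs_mul, abs_of_nonneg (by positivity : 0 ≤ c i k ^ 2 / 2)]
  gcongr
  linarith [abs_le_auxNorm ω i k]

theorem klDiv_polyaGammaLaw (c : Fin N → Fin K → ℝ) (ρ : Measure (Aux N K))
    [IsProbabilityMeasure ρ] :
    (klDiv ρ (polyaGammaLaw (fun _ _ => 1) c) ≠ ⊤ ↔ klDiv ρ auxBase ≠ ⊤) ∧
    (klDiv ρ auxBase ≠ ⊤ → (klDiv ρ (polyaGammaLaw (fun _ _ => 1) c)).toReal =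
      (klDiv ρ auxBase).toReal - ∑ i, ∑ k, Real.log (Real.cosh (c i k / 2)) +
        ∑ i, ∑ k, c i k ^ 2 / 2 * ∫ ω, ω i k ∂ρ) := by
  obtain ⟨D, hD⟩ := abs_polyaGammaLaw_exponent_le c
  have heq := polyaGammaLaw_eq_withExpDensity c
  have hp : IsProbabilityMeasure (withExpDensity (auxBase (N := N) (K := K)) (fun ω =>
      ∑ i, ∑ k, (Real.log (Real.cosh (c i k / 2)) - c i k ^ 2 / 2 * ω i k))) := by
    rw [← heq]; infer_instance
  have h := klDiv_withExpDensity (α := auxBase) (by fun_prop) measurable_auxNorm auxNorm_nonneg hD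
    (expIntegrable_auxNorm 0) (by rw [← heq]; exact expIntegrable_auxNorm c) ρ
  rw [← heq] at h
  refine ⟨h.1, fun hk => ?_⟩
  have hi := integrable_aux_of_klDiv hk
  have hi' (i : Fin N) (k : Fin K) : Integrable (fun ω : Aux N K =>
      Real.log (Real.cosh (c i k / 2)) - c i k ^ 2 / 2 * ω i k) ρ :=
    (integrable_const _).sub ((hi i k).const_mul _)
  rw [h.2 hk, integral_finsetSum _ fun i _ => integrable_finsetSum _ fun k _ => hi' i k]
  have hs (i : Fin N) : ∫ ω : Aux N K, ∑ k, (Real.log (Real.cosh (c i k / 2)) -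
      c i k ^ 2 / 2 * ω i k) ∂ρ = ∑ k, Real.log (Real.cosh (c i k / 2)) -
        ∑ k, c i k ^ 2 / 2 * ∫ ω, ω i k ∂ρ := by
    rw [integral_finsetSum _ fun k _ => hi' i k, ← Finset.sum_sub_distrib]
    refine Finset.sum_congr rfl fun k _ => ?_
    rw [integral_sub (integrable_const _) ((hi i k).const_mul _), integral_const_mul]
    simp
  rw [Finset.sum_congr rfl fun i _ => hs i]
  simp only [Finset.sum_sub_distrib]
  ring

/-- The coefficient of `E[ω_ik]` in the objective is `-c_ik² / 2`, exactly what passing from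
reference `PG(1, 0)` to `PG(1, c_ik)` absorbs. -/
theorem isOptimalAux_iff (X : Matrix (Fin N) (Fin M) ℝ) (y : Fin N → Fin K → Bool)
    {μ₀ : EuclideanSpace ℝ (Fin M)} {S₀ : Matrix (Fin M) (Fin M) ℝ} {qB : Measure (Weights M K)}
    [IsProbabilityMeasure qB] (h : klDiv qB (priorLaw μ₀ S₀) ≠ ⊤) (qΩ : Measure (Aux N K)) :
    IsOptimalAux X y μ₀ S₀ qB qΩ ↔
      qΩ = polyaGammaLaw (fun _ _ => 1) (updateC X (weightsMean qB) (weightsCov qB)) := by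
  set c := updateC X (weightsMean qB) (weightsCov qB) with hc
  have hsq (i : Fin N) (k : Fin K) : c i k ^ 2 / 2 = ∫ B, linPred X B i k ^ 2 / 2 ∂qB := by
    rw [hc, updateC_sq X (memLp_weights (integrable_norm_sq_of_klDiv h)), integral_div]
  refine maximizer_iff_of_eq_sub_klDiv (F := fun ρ => elbo X y μ₀ S₀ (qB.prod ρ))
    (C := -(klDiv qB (priorLaw μ₀ S₀)).toReal + ∫ B, linPart X y B ∂qB -
      ∑ i, ∑ k, Real.log (Real.cosh (c i k / 2))) (fun ρ hρ => ?_) (fun ρ hρ hk => ?_) qΩ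
  · rw [(elbo_prod X y μ₀ S₀ qB ρ).1, (klDiv_polyaGammaLaw c ρ).1]
    exact and_iff_right h
  · rw [(klDiv_polyaGammaLaw c ρ).1] at hk
    simp only [(elbo_prod X y μ₀ S₀ qB ρ).2 h hk, (klDiv_polyaGammaLaw c ρ).2 hk,
      Fintype.sum_prod_type, hsq]
    congr 1
    ring

theorem gaussianQuad_eq {m : EuclideanSpace ℝ (Fin M)} {P : Matrix (Fin M) (Fin M) ℝ}
    (hP : Pᵀ = P) (x : EuclideanSpace ℝ (Fin M)) :
    gaussianQuad m P x = x.ofLp ⬝ᵥ (P *ᵥ x.ofLp) - 2 * (x.ofLp ⬝ᵥ (P *ᵥ m.ofLp)) +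
      m.ofLp ⬝ᵥ (P *ᵥ m.ofLp) := by
  have h : m.ofLp ⬝ᵥ (P *ᵥ x.ofLp) = x.ofLp ⬝ᵥ (P *ᵥ m.ofLp) := by
    rw [Matrix.dotProduct_mulVec, ← Matrix.mulVec_transpose, hP, dotProduct_comm]
  rw [gaussianQuad, Matrix.mulVec_sub, sub_dotProduct, dotProduct_sub, dotProduct_sub, h]
  ring

theorem posDef_precision (X : Matrix (Fin N) (Fin M) ℝ) {S₀ : Matrix (Fin M) (Fin M) ℝ}
    (hS₀ : S₀.PosDef) {w : Fin N → Fin K → ℝ} (hw : ∀ i k, 0 ≤ w i k) (k : Fin K) :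
    (precision X S₀ w k).PosDef := by
  have h1 : (Matrix.diagonal fun i => w i k).PosSemidef := Matrix.PosSemidef.diagonal fun i => hw i k
  have h2 := h1.conjTranspose_mul_mul_same X
  rw [Matrix.conjTranspose_eq_transpose_of_trivial] at h2
  exact Matrix.PosDef.posSemidef_add h2 hS₀.inv

theorem transpose_of_posDef {P : Matrix (Fin M) (Fin M) ℝ} (hP : P.PosDef) : Pᵀ = P := by
  have := hP.isHermitian
  rwa [Matrix.IsHermitian, Matrix.conjTranspose_eq_transpose_of_trivial] at this

theorem gaussianQuad_prior_sub_update (X : Matrix (Fin N) (Fin M) ℝ) (y : Fin N → Fin K → Bool)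
    (μ₀ : EuclideanSpace ℝ (Fin M)) {S₀ : Matrix (Fin M) (Fin M) ℝ} (hS₀ : S₀.PosDef)
    {w : Fin N → Fin K → ℝ} (k : Fin K) (hP : (precision X S₀ w k).PosDef) :
    ∃ C : ℝ, ∀ B : Weights M K,
      gaussianQuad μ₀ S₀⁻¹ (B k) / 2 -
        gaussianQuad (updateM X y μ₀ S₀ w k) (updateS X S₀ w k)⁻¹ (B k) / 2 =
      C + ∑ i, (kappa y k i * linPred X B i k - w i k * (linPred X B i k ^ 2 / 2)) := by
  set P := precision X S₀ w k with hPdef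
  have hdet : IsUnit P.det := (Matrix.isUnit_iff_isUnit_det _).mp hP.isUnit
  have hinv : (updateS X S₀ w k)⁻¹ = P := Matrix.nonsing_inv_nonsing_inv P hdet
  set m := updateM X y μ₀ S₀ w k with hm
  -- The updated mean is the one that matches the terms linear in `B`; the quadratic terms differ by
  -- `Xᵀ W X`.
  have hPm : P *ᵥ m.ofLp = Xᵀ *ᵥ kappa y k + S₀⁻¹ *ᵥ μ₀.ofLp := by
    rw [hm, updateM, updateS, ← hPdef, Matrix.mulVec_mulVec, Matrix.mul_nonsing_inv P hdet,
      Matrix.one_mulVec]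
  refine ⟨μ₀.ofLp ⬝ᵥ (S₀⁻¹ *ᵥ μ₀.ofLp) / 2 - m.ofLp ⬝ᵥ (P *ᵥ m.ofLp) / 2, fun B => ?_⟩
  have hη : X *ᵥ (B k).ofLp = fun i => linPred X B i k := rfl
  have h1 : (B k).ofLp ⬝ᵥ (Xᵀ *ᵥ kappa y k) = ∑ i, kappa y k i * linPred X B i k := by
    rw [Matrix.dotProduct_mulVec, Matrix.vecMul_transpose, hη, dotProduct]
    exact Finset.sum_congr rfl fun i _ => mul_comm _ _
  have h2 : (B k).ofLp ⬝ᵥ (P *ᵥ (B k).ofLp) =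
      ∑ i, w i k * linPred X B i k ^ 2 + (B k).ofLp ⬝ᵥ (S₀⁻¹ *ᵥ (B k).ofLp) := by
    rw [hPdef, precision, Matrix.add_mulVec, dotProduct_add, ← Matrix.mulVec_mulVec,
      ← Matrix.mulVec_mulVec, Matrix.dotProduct_mulVec (B k).ofLp Xᵀ, Matrix.vecMul_transpose, hη]
    congr 1
    rw [dotProduct]
    refine Finset.sum_congr rfl fun i _ => ?_
    rw [Matrix.mulVec_diagonal]
    ring
  rw [hinv, gaussianQuad_eq (transpose_of_posDef hS₀.inv), gaussianQuad_eq (transpose_of_posDef hP),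
    hPm, dotProduct_add, h1, h2, Finset.sum_sub_distrib]
  have h3 : ∑ i, w i k * (linPred X B i k ^ 2 / 2) = (∑ i, w i k * linPred X B i k ^ 2) / 2 := by
    rw [Finset.sum_div]
    exact Finset.sum_congr rfl fun i _ => by ring
  rw [h3]
  ring

theorem exists_klDiv_gaussianLaw (m m' : Fin K → EuclideanSpace ℝ (Fin M))
    {S S' : Fin K → Matrix (Fin M) (Fin M) ℝ} (hS : ∀ k, (S k).PosDef) (hS' : ∀ k, (S' k).PosDef) :
    ∃ C : ℝ, ∀ ρ : Measure (Weights M K), IsProbabilityMeasure ρ →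
      (klDiv ρ (gaussianLaw m S) ≠ ⊤ ↔ klDiv ρ (gaussianLaw m' S') ≠ ⊤) ∧
      (klDiv ρ (gaussianLaw m' S') ≠ ⊤ → (klDiv ρ (gaussianLaw m S)).toReal =
        (klDiv ρ (gaussianLaw m' S')).toReal - ∫ B, (C + ∑ k,
          (gaussianQuad (m' k) (S' k)⁻¹ (B k) / 2 - gaussianQuad (m k) (S k)⁻¹ (B k) / 2)) ∂ρ) := by
  obtain ⟨C, hC⟩ := exists_gaussianLaw_eq_withExpDensity m m' hS hS'
  obtain ⟨D, hD⟩ := exists_abs_gaussianLaw_exponent_le m m' (fun k => (S k)⁻¹) (fun k => (S' k)⁻¹) C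
  have hp : IsProbabilityMeasure (withExpDensity (gaussianLaw m' S') (fun B => C + ∑ k,
      (gaussianQuad (m' k) (S' k)⁻¹ (B k) / 2 - gaussianQuad (m k) (S k)⁻¹ (B k) / 2))) := by
    rw [← hC]; infer_instance
  refine ⟨C, fun ρ hρ => ?_⟩
  have h := klDiv_withExpDensity (α := gaussianLaw m' S') (by fun_prop)
    (n := fun B => ‖B‖ ^ 2) (by fun_prop) (fun B => by positivity) hD
    (expIntegrable_norm_sq_gaussianLaw _ _)
    (by rw [← hC]; exact expIntegrable_norm_sq_gaussianLaw _ _) ρ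
  rwa [← hC] at h

theorem klDiv_gaussianLaw_ne_top (m m' : Fin K → EuclideanSpace ℝ (Fin M))
    {S S' : Fin K → Matrix (Fin M) (Fin M) ℝ} (hS : ∀ k, (S k).PosDef) (hS' : ∀ k, (S' k).PosDef) :
    klDiv (gaussianLaw m S) (gaussianLaw m' S') ≠ ⊤ := by
  obtain ⟨C, hC⟩ := exists_klDiv_gaussianLaw m m' hS hS'
  exact (hC (gaussianLaw m S) inferInstance).1.mp (by simp [klDiv_self])

theorem klDiv_polyaGammaLaw_ne_top (c : Fin N → Fin K → ℝ) :
    klDiv (polyaGammaLaw (fun _ _ => 1) c) auxBase ≠ ⊤ :=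
  (klDiv_polyaGammaLaw c (polyaGammaLaw (fun _ _ => 1) c)).1.mp (by simp [klDiv_self])

theorem integrable_linPart (X : Matrix (Fin N) (Fin M) ℝ) (y : Fin N → Fin K → Bool)
    {q : Measure (Weights M K)} [IsProbabilityMeasure q] (h : Integrable (fun B => ‖B‖ ^ 2) q) :
    Integrable (linPart X y) q := by
  obtain ⟨C, hC⟩ := abs_linPart_le (K := K) X y one_pos
  exact ((integrable_const C).add (h.const_mul 1)).mono' (by fun_prop) (Eventually.of_forall hC)

theorem integrable_linPred_sq (X : Matrix (Fin N) (Fin M) ℝ) {q : Measure (Weights M K)}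
    (h : Integrable (fun B => ‖B‖ ^ 2) q) (i : Fin N) (k : Fin K) :
    Integrable (fun B => linPred X B i k ^ 2 / 2) q :=
  (h.const_mul _).mono' (by fun_prop) (Eventually.of_forall fun B => by
    rw [Real.norm_of_nonneg (by positivity)]
    exact linPred_sq_le X B i k)

/-- By completing the square, the exponent relating prior and updated Gaussian equals, up to a
constant, the integrand the objective adds to the entropy. -/
theorem isOptimalWeights_iff (X : Matrix (Fin N) (Fin M) ℝ) (y : Fin N → Fin K → Bool)
    (μ₀ : EuclideanSpace ℝ (Fin M)) {S₀ : Matrix (Fin M) (Fin M) ℝ} (hS₀ : S₀.PosDef)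
    {qΩ : Measure (Aux N K)} [IsProbabilityMeasure qΩ] (h : klDiv qΩ auxBase ≠ ⊤)
    (hP : ∀ k, (precision X S₀ (auxMean qΩ) k).PosDef) (qB : Measure (Weights M K)) :
    IsOptimalWeights X y μ₀ S₀ qΩ qB ↔
      qB = gaussianLaw (updateM X y μ₀ S₀ (auxMean qΩ)) (updateS X S₀ (auxMean qΩ)) := by
  set w := auxMean qΩ with hw
  choose c hc using fun k => gaussianQuad_prior_sub_update X y μ₀ hS₀ k (hP k)
  obtain ⟨D, hD⟩ := exists_klDiv_gaussianLaw (updateM X y μ₀ S₀ w) (fun _ => μ₀)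
    (S := updateS X S₀ w) (S' := fun _ => S₀) (fun k => (hP k).inv) (fun _ => hS₀)
  -- The `log 2` terms compensate those inside `linPart`.
  set A := D + ∑ k, c k + ∑ _i : Fin N, ∑ _k : Fin K, Real.log 2 with hA
  have hexp (B : Weights M K) : D + ∑ k, (gaussianQuad μ₀ S₀⁻¹ (B k) / 2 -
      gaussianQuad (updateM X y μ₀ S₀ w k) (updateS X S₀ w k)⁻¹ (B k) / 2) =
      A + linPart X y B - ∑ j : Fin N × Fin K, linPred X B j.1 j.2 ^ 2 / 2 * w j.1 j.2 := by
    rw [Finset.sum_congr rfl fun k _ => hc k B, Finset.sum_add_distrib, hA, linPart,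
      Fintype.sum_prod_type, Finset.sum_comm]
    simp only [Finset.sum_sub_distrib, mul_comm (w _ _)]
    ring
  refine maximizer_iff_of_eq_sub_klDiv (F := fun ρ => elbo X y μ₀ S₀ (ρ.prod qΩ))
    (C := -(klDiv qΩ auxBase).toReal - A) (fun ρ hρ => ?_) (fun ρ hρ hk => ?_) qB
  · rw [(elbo_prod X y μ₀ S₀ ρ qΩ).1, (hD ρ hρ).1]
    exact and_iff_left h
  · rw [(hD ρ hρ).1] at hk
    have hi := integrable_norm_sq_of_klDiv hk
    have hint : ∫ B, (D + ∑ k, (gaussianQuad μ₀ S₀⁻¹ (B k) / 2 -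
        gaussianQuad (updateM X y μ₀ S₀ w k) (updateS X S₀ w k)⁻¹ (B k) / 2)) ∂ρ =
        A + ∫ B, linPart X y B ∂ρ -
          ∑ j : Fin N × Fin K, (∫ B, linPred X B j.1 j.2 ^ 2 / 2 ∂ρ) * w j.1 j.2 := by
      have h1 := integrable_linPart X y hi
      have h2 (j : Fin N × Fin K) := (integrable_linPred_sq X hi j.1 j.2).mul_const (w j.1 j.2)
      have h3 : Integrable (fun B => A + linPart X y B) ρ := (integrable_const A).add h1
      simp_rw [hexp]
      rw [integral_sub h3 (integrable_finsetSum _ fun j _ => h2 j),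
        integral_add (integrable_const A) h1, integral_finsetSum _ fun j _ => h2 j]
      simp [integral_mul_const]
    simp only [(elbo_prod X y μ₀ S₀ ρ qΩ).2 hk h, (hD ρ hρ).2 hk, hint]
    congr 1
    simp only [hw, auxMean]
    ring

/-- Finite entropy forces absolute continuity, so `ω ≥ 0` almost surely; this makes the updated
precision positive definite. -/
theorem auxMean_nonneg {q : Measure (Aux N K)} (h : klDiv q auxBase ≠ ⊤) (i : Fin N) (k : Fin K) :
    0 ≤ auxMean q i k :=
  integral_nonneg_of_ae ((klDiv_ne_top_iff.mp h).1.ae_le (ae_nonneg_polyaGammaLaw 0 i k))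

end IBLogit

end

/-! ### The optimal updates and coordinate ascent -/

theorem mainTheorem7 {N M K : ℕ} (X : Matrix (Fin N) (Fin M) ℝ) (y : Fin N → Fin K → Bool)
    (μ₀ : EuclideanSpace ℝ (Fin M)) (S₀ : Matrix (Fin M) (Fin M) ℝ) (hS₀ : S₀.PosDef) :
    -- Optimal update of `q(Ω)`, for an arbitrary current `q(B)` with a finite objective.
    (∀ qB : Measure (IBLogit.Weights M K), IsProbabilityMeasure qB →
      (∃ ρ : Measure (IBLogit.Aux N K), IsProbabilityMeasure ρ ∧
        IBLogit.elbo X y μ₀ S₀ (qB.prod ρ) ≠ ⊥) →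
      (∀ k, MemLp (fun B : IBLogit.Weights M K => B k) 2 qB) ∧
      ∀ qΩ : Measure (IBLogit.Aux N K),
        IBLogit.IsOptimalAux X y μ₀ S₀ qB qΩ ↔
          qΩ = IBLogit.polyaGammaLaw (fun _ _ => 1)
            (IBLogit.updateC X (IBLogit.weightsMean qB) (IBLogit.weightsCov qB))) ∧
    -- Optimal update of `q(B)`, for an arbitrary current `q(Ω)` with a finite objective.
    (∀ qΩ : Measure (IBLogit.Aux N K), IsProbabilityMeasure qΩ →
      (∃ ρ : Measure (IBLogit.Weights M K), IsProbabilityMeasure ρ ∧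
        IBLogit.elbo X y μ₀ S₀ (ρ.prod qΩ) ≠ ⊥) →
      (∀ i k, Integrable (fun ω : IBLogit.Aux N K => ω i k) qΩ) ∧
      (∀ k, (IBLogit.precision X S₀ (IBLogit.auxMean qΩ) k).PosDef) ∧
      ∀ qB : Measure (IBLogit.Weights M K),
        IBLogit.IsOptimalWeights X y μ₀ S₀ qΩ qB ↔
          qB = IBLogit.gaussianLaw (IBLogit.updateM X y μ₀ S₀ (IBLogit.auxMean qΩ))
            (IBLogit.updateS X S₀ (IBLogit.auxMean qΩ))) ∧
    -- The factors of the parametric family: finite objective, moments.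
    (∀ (m : Fin K → EuclideanSpace ℝ (Fin M)) (S : Fin K → Matrix (Fin M) (Fin M) ℝ)
      (c : Fin N → Fin K → ℝ), (∀ k, (S k).PosDef) →
      IBLogit.elbo X y μ₀ S₀
        ((IBLogit.gaussianLaw m S).prod (IBLogit.polyaGammaLaw (fun _ _ => 1) c)) ≠ ⊥ ∧
      IBLogit.weightsMean (IBLogit.gaussianLaw m S) = m ∧
      IBLogit.weightsCov (IBLogit.gaussianLaw m S) = S ∧
      IBLogit.auxMean (IBLogit.polyaGammaLaw (fun _ _ => 1) c) =
        fun i k => IBLogit.polyaGammaMean 1 (c i k)) ∧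
    -- The algorithm: a run of optimal coordinate ascent is the closed-form iteration.
    (∀ (qB : ℕ → Measure (IBLogit.Weights M K)) (qΩ : ℕ → Measure (IBLogit.Aux N K)),
      IsProbabilityMeasure (qB 0) →
      (∃ ρ : Measure (IBLogit.Aux N K), IsProbabilityMeasure ρ ∧
        IBLogit.elbo X y μ₀ S₀ ((qB 0).prod ρ) ≠ ⊥) →
      (IBLogit.IsCAVIRun X y μ₀ S₀ qB qΩ ↔
        ∀ t, qΩ t = IBLogit.polyaGammaLaw (fun _ _ => 1)
              (IBLogit.updateC X
                (IBLogit.paramIter X y μ₀ S₀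
                  (IBLogit.weightsMean (qB 0)) (IBLogit.weightsCov (qB 0)) t).1
                (IBLogit.paramIter X y μ₀ S₀
                  (IBLogit.weightsMean (qB 0)) (IBLogit.weightsCov (qB 0)) t).2) ∧
            qB (t + 1) = IBLogit.gaussianLaw
              (IBLogit.paramIter X y μ₀ S₀
                (IBLogit.weightsMean (qB 0)) (IBLogit.weightsCov (qB 0)) (t + 1)).1
              (IBLogit.paramIter X y μ₀ S₀
                (IBLogit.weightsMean (qB 0)) (IBLogit.weightsCov (qB 0)) (t + 1)).2)) := by
  have h1 : ∀ qB : Measure (IBLogit.Weights M K), IsProbabilityMeasure qB →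
      (∃ ρ : Measure (IBLogit.Aux N K), IsProbabilityMeasure ρ ∧
        IBLogit.elbo X y μ₀ S₀ (qB.prod ρ) ≠ ⊥) →
      (∀ k, MemLp (fun B : IBLogit.Weights M K => B k) 2 qB) ∧
      ∀ qΩ : Measure (IBLogit.Aux N K),
        IBLogit.IsOptimalAux X y μ₀ S₀ qB qΩ ↔
          qΩ = IBLogit.polyaGammaLaw (fun _ _ => 1)
            (IBLogit.updateC X (IBLogit.weightsMean qB) (IBLogit.weightsCov qB)) := by
    rintro qB hq ⟨ρ, hρ, hne⟩
    have hk := ((IBLogit.elbo_prod X y μ₀ S₀ qB ρ).1.mp hne).1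
    exact ⟨IBLogit.memLp_weights (IBLogit.integrable_norm_sq_of_klDiv hk),
      IBLogit.isOptimalAux_iff X y hk⟩
  have h2 : ∀ qΩ : Measure (IBLogit.Aux N K), IsProbabilityMeasure qΩ →
      (∃ ρ : Measure (IBLogit.Weights M K), IsProbabilityMeasure ρ ∧
        IBLogit.elbo X y μ₀ S₀ (ρ.prod qΩ) ≠ ⊥) →
      (∀ i k, Integrable (fun ω : IBLogit.Aux N K => ω i k) qΩ) ∧
      (∀ k, (IBLogit.precision X S₀ (IBLogit.auxMean qΩ) k).PosDef) ∧
      ∀ qB : Measure (IBLogit.Weights M K),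
        IBLogit.IsOptimalWeights X y μ₀ S₀ qΩ qB ↔
          qB = IBLogit.gaussianLaw (IBLogit.updateM X y μ₀ S₀ (IBLogit.auxMean qΩ))
            (IBLogit.updateS X S₀ (IBLogit.auxMean qΩ)) := by
    rintro qΩ hq ⟨ρ, hρ, hne⟩
    have hk := ((IBLogit.elbo_prod X y μ₀ S₀ ρ qΩ).1.mp hne).2
    have hP := fun k => IBLogit.posDef_precision X hS₀ (IBLogit.auxMean_nonneg hk) k
    exact ⟨IBLogit.integrable_aux_of_klDiv hk, hP, IBLogit.isOptimalWeights_iff X y μ₀ hS₀ hk hP⟩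
  refine ⟨h1, h2, fun m S c hS => ⟨?_, IBLogit.weightsMean_gaussianLaw m S,
    IBLogit.weightsCov_gaussianLaw m hS, IBLogit.auxMean_polyaGammaLaw c⟩, ?_⟩
  · exact (IBLogit.elbo_prod X y μ₀ S₀ _ _).1.mpr
      ⟨IBLogit.klDiv_gaussianLaw_ne_top m _ hS fun _ => hS₀, IBLogit.klDiv_polyaGammaLaw_ne_top c⟩
  intro qB qΩ hq0 hfin0
  set p := IBLogit.paramIter X y μ₀ S₀ (IBLogit.weightsMean (qB 0)) (IBLogit.weightsCov (qB 0)) with hp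
  -- One sweep from a current factor with finite objective and the parameters of step `t`.
  have step (t : ℕ) (hqt : IsProbabilityMeasure (qB t))
      (hfin : ∃ ρ : Measure (IBLogit.Aux N K), IsProbabilityMeasure ρ ∧
        IBLogit.elbo X y μ₀ S₀ ((qB t).prod ρ) ≠ ⊥)
      (hm : IBLogit.weightsMean (qB t) = (p t).1) (hS : IBLogit.weightsCov (qB t) = (p t).2) :
      ((IBLogit.IsOptimalAux X y μ₀ S₀ (qB t) (qΩ t) ∧
        IBLogit.IsOptimalWeights X y μ₀ S₀ (qΩ t) (qB (t + 1))) ↔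
      (qΩ t = IBLogit.polyaGammaLaw (fun _ _ => 1) (IBLogit.updateC X (p t).1 (p t).2) ∧
        qB (t + 1) = IBLogit.gaussianLaw (p (t + 1)).1 (p (t + 1)).2)) ∧
      (qB (t + 1) = IBLogit.gaussianLaw (p (t + 1)).1 (p (t + 1)).2 →
        IsProbabilityMeasure (qB (t + 1)) ∧
        (∃ ρ : Measure (IBLogit.Aux N K), IsProbabilityMeasure ρ ∧
          IBLogit.elbo X y μ₀ S₀ ((qB (t + 1)).prod ρ) ≠ ⊥) ∧
        IBLogit.weightsMean (qB (t + 1)) = (p (t + 1)).1 ∧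
        IBLogit.weightsCov (qB (t + 1)) = (p (t + 1)).2) := by
    have hkB := (hfin.elim fun ρ h => have := h.1
      ((IBLogit.elbo_prod X y μ₀ S₀ (qB t) ρ).1.mp h.2).1)
    set c := IBLogit.updateC X (p t).1 (p t).2 with hc
    have hkΩ := IBLogit.klDiv_polyaGammaLaw_ne_top c
    obtain ⟨-, hP, hopt⟩ := h2 (IBLogit.polyaGammaLaw (fun _ _ => 1) c) inferInstance
      ⟨qB t, hqt, (IBLogit.elbo_prod X y μ₀ S₀ _ _).1.mpr ⟨hkB, hkΩ⟩⟩
    -- The weights now have the form used in `paramIter`, so the update parameters are `p (t + 1)`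
    -- by definition.
    rw [IBLogit.auxMean_polyaGammaLaw] at hP hopt
    have hPS : ∀ k, ((p (t + 1)).2 k).PosDef := fun k => (hP k).inv
    refine ⟨?_, fun hB => ?_⟩
    · rw [(h1 (qB t) hqt hfin).2, hm, hS]
      refine and_congr_right fun hΩ => ?_
      rw [hΩ]
      exact hopt (qB (t + 1))
    · rw [hB]
      exact ⟨inferInstance, ⟨IBLogit.polyaGammaLaw (fun _ _ => 1) c, inferInstance,
        (IBLogit.elbo_prod X y μ₀ S₀ _ _).1.mpr
          ⟨IBLogit.klDiv_gaussianLaw_ne_top _ _ hPS fun _ => hS₀, hkΩ⟩⟩,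
        IBLogit.weightsMean_gaussianLaw _ _, IBLogit.weightsCov_gaussianLaw _ hPS⟩
  -- The hypothesis asks for the Gaussian form only at states already satisfying the invariant; this
  -- lets it serve both directions, a run supplying it through `step` and the closed form directly.
  have inv (hB : ∀ t, IsProbabilityMeasure (qB t) →
      (∃ ρ : Measure (IBLogit.Aux N K), IsProbabilityMeasure ρ ∧
        IBLogit.elbo X y μ₀ S₀ ((qB t).prod ρ) ≠ ⊥) →
      IBLogit.weightsMean (qB t) = (p t).1 → IBLogit.weightsCov (qB t) = (p t).2 →
      qB (t + 1) = IBLogit.gaussianLaw (p (t + 1)).1 (p (t + 1)).2) (t : ℕ) :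
      IsProbabilityMeasure (qB t) ∧
      (∃ ρ : Measure (IBLogit.Aux N K), IsProbabilityMeasure ρ ∧
        IBLogit.elbo X y μ₀ S₀ ((qB t).prod ρ) ≠ ⊥) ∧
      IBLogit.weightsMean (qB t) = (p t).1 ∧ IBLogit.weightsCov (qB t) = (p t).2 := by
    induction t with
    | zero => exact ⟨hq0, hfin0, rfl, rfl⟩
    | succ t ih =>
      obtain ⟨a, b, c, d⟩ := ih
      exact (step t a b c d).2 (hB t a b c d)
  constructor
  · intro hrun t
    obtain ⟨a, b, c, d⟩ := inv (fun t a b c d => ((step t a b c d).1.mp (hrun t)).2) t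
    exact (step t a b c d).1.mp (hrun t)
  · intro hform t
    obtain ⟨a, b, c, d⟩ := inv (fun t _ _ _ _ => (hform t).2) t
    exact (step t a b c d).1.mpr (hform t)
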